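/- Let $d\ge 2$ and $0<s<\frac d2$. For $r>0$ let $B_r\subset\mathbb R^d$ be the open ball of radius $r$ centred at the origin, and let $$\mathscr L^1_{2s}(\mathbb R^d)=\Big\{u\in L^1_{loc}(\mathbb R^d):\int_{\mathbb R^d}\frac{|u(x)|}{(1+|x|)^{d+2s}}\,dx<\infty\Big\}$$ (real-valued functions). For $\varphi\in C_c^\infty(\mathbb R^d)$ let $(-\Delta)^s\varphi=\mathscr F^{-1}\big[|\cdot|^{2s}\mathscr F[\varphi]\big]$, where $\mathscr F[\varphi](\xi)=\int_{\mathbb R^d} e^{-ix\cdot\xi}\varphi(x)\,dx$. For $u\in\mathscr L^1_{2s}(\mathbb R^d)$ and $\Omega\subset\mathbb R^d$ open, $(-\Delta)^su=0$ in $\mathscr D'(\Omega)$ means that $\int_{\mathbb R^d}u\,(-\Delta)^s\varphi\,dx=0$ for all $\varphi\in C_c^\infty(\Omega)$. For every multi-index $n\in\mathbb N^d$ there is a constant $C>0$ depending only on $d$, $s$ and $n$ such that the following holds. Let $R>0$ and let $u\in\mathscr L^1_{2s}(\mathbb R^d)$ satisfy $$(-\Delta)^su=0\quad\text{in }\mathscr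 D'(B_{2R}).$$ Then, after modification on a null set, $u\in C^\infty(\overline{B_R})$, that is, $u$ agrees on $\overline{B_R}$ with a function in $C^\infty(\mathbb R^d)$. Moreover, for every multi-index $n\in\mathbb N^d$, with the corresponding constant $C$, $$\|D^nu\|_{L^\infty(\overline{B_R})}\le C\,R^{2s-|n|}\int_{\mathbb R^d}\frac{|u(x)|}{R^{d+2s}+|x|^{d+2s}}\,dx .$$ -/

import Mathlib

open MeasureTheory
open scoped ContDiff FourierTransform Distributions

namespace FractionalLaplacian

/-- Membership in the weighted space `𝓛¹_{2s}(ℝᵈ)`: `u` is locally integrable and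
`∫ |u(x)| / (1 + |x|)^(d + 2s) dx < ∞`. -/
def MemWeightedL1 {d : ℕ} (s : ℝ) (u : EuclideanSpace ℝ (Fin d) → ℝ) : Prop :=
  LocallyIntegrable u volume ∧
    Integrable (fun x => |u x| / (1 + ‖x‖) ^ ((d : ℝ) + 2 * s)) volume

/-- The fractional Laplacian `(-Δ)^s φ = 𝓕⁻¹[|·|^(2s) 𝓕 φ]` of a real-valued function `φ` (meant
for smooth and rapidly decaying `φ`), as a complex-valued function. Mathlib's Fourier transform has
the kernel `exp (-2πi⟨x, ξ⟩)`, so the Fourier variable that belongs to `-i∇` is `2πξ`, and the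
symbol is `|2πξ|^(2s)`. -/
noncomputable def fracLaplacian {d : ℕ} (s : ℝ) (φ : EuclideanSpace ℝ (Fin d) → ℝ) :
    EuclideanSpace ℝ (Fin d) → ℂ :=
  𝓕⁻ (fun ξ : EuclideanSpace ℝ (Fin d) =>
    (((2 * Real.pi * ‖ξ‖) ^ (2 * s) : ℝ) : ℂ) *
      𝓕 (fun x : EuclideanSpace ℝ (Fin d) => (φ x : ℂ)) ξ)

/-- `(-Δ)^s u = 0` in `𝓓'(Ω)`: `∫ u (-Δ)^s φ dx = 0` for every test function `φ ∈ C_c^∞(Ω)`. -/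
def IsDistribHarmonic {d : ℕ} (s : ℝ) (Ω : TopologicalSpace.Opens (EuclideanSpace ℝ (Fin d)))
    (u : EuclideanSpace ℝ (Fin d) → ℝ) : Prop :=
  ∀ φ : 𝓓(Ω, ℝ), ∫ x, (u x : ℂ) * fracLaplacian s φ x = 0

/-- The open ball of radius `r` centred at the origin, as an open set. -/
def openBall (d : ℕ) (r : ℝ) : TopologicalSpace.Opens (EuclideanSpace ℝ (Fin d)) :=
  ⟨Metric.ball 0 r, Metric.isOpen_ball⟩

/-- The partial derivative `∂f/∂xᵢ`. -/
noncomputable def partialDeriv {d : ℕ} (i : Fin d) (f : EuclideanSpace ℝ (Fin d) → ℝ) :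
    EuclideanSpace ℝ (Fin d) → ℝ :=
  fun x => fderiv ℝ f x (EuclideanSpace.single i 1)

/-- The derivative `Dⁿ f = ∂₁^(n₁) ⋯ ∂_d^(n_d) f` of multi-index `n`. -/
noncomputable def multiDeriv {d : ℕ} (n : Fin d → ℕ) (f : EuclideanSpace ℝ (Fin d) → ℝ) :
    EuclideanSpace ℝ (Fin d) → ℝ :=
  (List.finRange d).foldr (fun i g => (partialDeriv i)^[n i] g) f

end FractionalLaplacian

/-!
The proof represents `u` locally as its convolution with a smooth kernel.

After rescaling, `R = 1`. Suppose there is an integrable function `E`, supported in the ball of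
radius `1/4`, with `(-Δ)^s E = δ₀ - K`, where `K` is smooth and all its derivatives are
`O(‖x‖^(-d-2s))`. For a test function `ψ` supported in the ball of radius `3/2`, the function `E ⋆ ψ`
is a test function in the ball of radius `2` with `(-Δ)^s (E ⋆ ψ) = ψ - K ⋆ ψ`. Since `u` is
`s`-harmonic there, `∫ u ψ = ∫ u (K ⋆ ψ)`, hence `u(x) = v(x) := ∫ u(y) K(y - x) dy` for almost
every `x` in that ball (`ae_eq_convolution_of_isDistribHarmonic`). The function `v` is smooth on the
whole space, and putting the derivatives on `K` gives the estimate (`SmoothDecay.contDiff_integral`).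

The parametrix (`exists_parametrix`) is built from dilations of one function `G`, smooth and
supported in the unit ball, with Fourier transform `γ(‖ξ‖) ≥ 0` vanishing at the origin to an order
above `2s`. By homogeneity, for `ξ ≠ 0`,
`(2π‖ξ‖)^(2s) = c₁ ∫₀^∞ r^(-2s-1) γ(r‖ξ‖) dr` and `(2π‖ξ‖)^(-2s) = c₂ ∫₀^∞ t^(2s-1) γ(t‖ξ‖) dt`.
Let `𝓕 E` be the part `t ≤ 1/4` of the second integral: `E` is supported in the ball of radius
`1/4`, and `𝓕 K = 1 - (2π‖ξ‖)^(2s) 𝓕 E` is `(2π‖ξ‖)^(2s)` times the part `t > 1/4`, which decays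
rapidly, so `K` is smooth. For the decay of `K`, let `𝓕 N` be the part `r > 1/4` of the first
integral. The function `N` and its derivatives decay like `‖x‖^(-d-2s)`, because only the scales
`r ≥ ‖x‖` contribute at `x` (`smoothDecay_dilationAverage`). The remaining scales `r ≤ 1/4` are
supported in the ball of radius `1/4`, so that `K + N ⋆ E` vanishes outside the ball of radius `1/2`
(`IsRadialProfile.integral_small_scale_eq_zero`), and there `K = -N ⋆ E` inherits the decay of `N`.
The argument uses neither an explicit fundamental solution nor a restriction to `s < 1`.
-/

open scoped Topology

namespace FractionalLaplacian

/-! ### Parametric integrals and kernels with decay -/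

/-- Differentiation under the integral sign to all orders, for a family of smooth functions whose
derivatives are dominated locally uniformly. -/
theorem hasFTaylorSeriesUpTo_integral {α V F : Type*} [MeasurableSpace α] {μ : Measure α}
    [NormedAddCommGroup V] [NormedSpace ℝ V] [NormedAddCommGroup F] [NormedSpace ℝ F]
    [CompleteSpace F] {f : α → V → F} (hf : ∀ t, ContDiff ℝ ∞ (f t))
    (hmeas : ∀ n x, AEStronglyMeasurable (fun t => iteratedFDeriv ℝ n (f t) x) μ)
    (hbound : ∀ n x₀, ∃ ε > 0, ∃ b : α → ℝ, Integrable b μ ∧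
      ∀ᵐ t ∂μ, ∀ x ∈ Metric.ball x₀ ε, ‖iteratedFDeriv ℝ n (f t) x‖ ≤ b t) :
    HasFTaylorSeriesUpTo ∞ (fun x => ∫ t, f t x ∂μ)
      (fun x n => ∫ t, iteratedFDeriv ℝ n (f t) x ∂μ) := by
  have hint : ∀ n x, Integrable (fun t => iteratedFDeriv ℝ n (f t) x) μ := by
    intro n x
    obtain ⟨ε, hε, b, hb, h⟩ := hbound n x
    exact hb.mono' (hmeas n x) (h.mono fun t ht => ht x (Metric.mem_ball_self hε))
  have hder : ∀ (m : ℕ) (x : V), HasFDerivAt (fun y => ∫ t, iteratedFDeriv ℝ m (f t) y ∂μ)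
      (∫ t, iteratedFDeriv ℝ (m + 1) (f t) x ∂μ).curryLeft x := by
    intro m x
    obtain ⟨ε, hε, b, hb, h⟩ := hbound (m + 1) x
    let Φ : (V [×(m + 1)]→L[ℝ] F) ≃ₗᵢ[ℝ] (V →L[ℝ] V [×m]→L[ℝ] F) :=
      continuousMultilinearCurryLeftEquiv ℝ (fun _ : Fin (m + 1) => V) F
    have key := hasFDerivAt_integral_of_dominated_of_fderiv_le (𝕜 := ℝ)
      (F := fun y t => iteratedFDeriv ℝ m (f t) y)
      (F' := fun y t => Φ (iteratedFDeriv ℝ (m + 1) (f t) y))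
      (bound := b) (μ := μ) (x₀ := x) (Metric.ball_mem_nhds x hε)
      (Filter.Eventually.of_forall fun y => hmeas m y) (hint m x)
      (Φ.continuous.comp_aestronglyMeasurable (hmeas (m + 1) x))
      (by
        filter_upwards [h] with t ht y hy
        exact (Φ.norm_map _).le.trans (ht y hy))
      hb
      (by
        filter_upwards with t y _
        have : DifferentiableAt ℝ (iteratedFDeriv ℝ m (f t)) y :=
          ((hf t).differentiable_iteratedFDeriv (by exact_mod_cast ENat.natCast_lt_top m)) y
        exact this.hasFDerivAt)
    have hΦ := (ContinuousLinearMap.integral_comp_comm (𝕜 := ℝ) (Fₗ := V →L[ℝ] V [×m]→L[ℝ] F)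
      Φ.toContinuousLinearEquiv.toContinuousLinearMap (hint (m + 1) x)).symm
    exact key.congr_fderiv hΦ.symm
  refine ⟨fun x => ?_, fun m _ x => hder m x, fun m _ => ?_⟩
  · exact (ContinuousMultilinearMap.apply ℝ (fun _ : Fin 0 => V) F 0).integral_comp_comm
      (hint 0 x) |>.symm.trans (by simp)
  · exact continuous_iff_continuousAt.2 fun x => (hder m x).continuousAt

/-- Peetre's inequality: moving the weight by `x` costs at most `(1 + ‖x‖)^a`. -/
theorem one_add_norm_rpow_neg_le {V : Type*} [SeminormedAddCommGroup V] {a : ℝ}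
    (ha : 0 ≤ a) (x y : V) :
    (1 + ‖x - y‖) ^ (-a) ≤ (1 + ‖x‖) ^ a * (1 + ‖y‖) ^ (-a) := by
  rw [Real.rpow_neg (by positivity), Real.rpow_neg (by positivity), ← div_eq_mul_inv,
    inv_le_comm₀ (by positivity) (by positivity), inv_div, ← Real.div_rpow (by positivity)
    (by positivity)]
  apply Real.rpow_le_rpow (by positivity) _ ha
  rw [div_le_iff₀ (by positivity)]
  have : ‖y‖ ≤ ‖x - y‖ + ‖x‖ := by
    calc ‖y‖ = ‖x - (x - y)‖ := by simp
      _ ≤ ‖x‖ + ‖x - y‖ := norm_sub_le _ _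
      _ = _ := add_comm _ _
  nlinarith [norm_nonneg x, norm_nonneg (x - y)]

theorem integrable_mul_one_add_norm_sub {V : Type*} [NormedAddCommGroup V]
    [MeasurableSpace V] [BorelSpace V] {μ : Measure V} {a : ℝ} {u : V → ℝ} (ha : 0 ≤ a)
    (hum : AEStronglyMeasurable u μ) (hu : Integrable (fun y => |u y| * (1 + ‖y‖) ^ (-a)) μ)
    (x : V) : Integrable (fun y => |u y| * (1 + ‖x - y‖) ^ (-a)) μ := by
  refine (hu.const_mul ((1 + ‖x‖) ^ a)).mono' (hum.norm.mul ?_)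
    (Filter.Eventually.of_forall fun y => ?_)
  · have : Continuous (fun y : V => (1 + ‖x - y‖) ^ (-a)) :=
      Continuous.rpow_const (by fun_prop) (fun y => Or.inl (by positivity))
    exact this.aestronglyMeasurable
  · rw [Real.norm_of_nonneg (by positivity), mul_left_comm]
    gcongr
    exact one_add_norm_rpow_neg_le ha x y

/-- Smooth functions all of whose derivatives are `O((1 + ‖x‖)^(-a))`. -/
def SmoothDecay {V F : Type*} [NormedAddCommGroup V] [NormedSpace ℝ V] [NormedAddCommGroup F]
    [NormedSpace ℝ F] (a : ℝ) (f : V → F) : Prop :=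
  ContDiff ℝ ∞ f ∧ ∀ n : ℕ, ∃ C : ℝ, ∀ x, ‖iteratedFDeriv ℝ n f x‖ ≤ C * (1 + ‖x‖) ^ (-a)

section
variable {V F : Type*} [NormedAddCommGroup V] [NormedSpace ℝ V] [NormedAddCommGroup F]
    [NormedSpace ℝ F] {a : ℝ} {f : V → F}

theorem SmoothDecay.bound (hf : SmoothDecay a f) (n : ℕ) :
    ∃ C : ℝ, 0 < C ∧ ∀ x, ‖iteratedFDeriv ℝ n f x‖ ≤ C * (1 + ‖x‖) ^ (-a) := by
  obtain ⟨C, hC⟩ := hf.2 n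
  refine ⟨max C 1, by positivity, fun x => (hC x).trans ?_⟩
  gcongr
  exact le_max_left _ _

theorem SmoothDecay.norm_le (hf : SmoothDecay a f) :
    ∃ C : ℝ, 0 < C ∧ ∀ x, ‖f x‖ ≤ C * (1 + ‖x‖) ^ (-a) := by
  obtain ⟨C, hC, h⟩ := hf.bound 0
  exact ⟨C, hC, fun x => by simpa using h x⟩

theorem SmoothDecay.comp_neg (hf : SmoothDecay a f) : SmoothDecay a (fun x => f (-x)) := by
  refine ⟨hf.1.comp contDiff_neg, fun n => ?_⟩
  obtain ⟨C, hC⟩ := hf.2 n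
  refine ⟨C, fun x => ?_⟩
  have := (LinearIsometryEquiv.neg ℝ (E := V)).norm_iteratedFDeriv_comp_right f x n
  have h2 : (f ∘ (LinearIsometryEquiv.neg ℝ (E := V))) = fun x => f (-x) := rfl
  rw [h2] at this
  rw [this]
  simpa using hC (-x)

theorem SmoothDecay.clm_comp {F' : Type*} [NormedAddCommGroup F'] [NormedSpace ℝ F']
    (hf : SmoothDecay a f) (L : F →L[ℝ] F') : SmoothDecay a (fun x => L (f x)) := by
  refine ⟨L.contDiff.comp hf.1, fun n => ?_⟩
  obtain ⟨C, hC⟩ := hf.2 n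
  refine ⟨‖L‖ * C, fun x => ?_⟩
  have := L.norm_iteratedFDeriv_comp_left (hf.1.contDiffAt (x := x)) (n := n)
    (by exact_mod_cast le_top)
  refine this.trans ?_
  rw [mul_assoc]
  gcongr
  exact hC x

/-- A smooth function that agrees far out with a function of class `SmoothDecay a` is itself of
this class. -/
theorem SmoothDecay.of_eqOn_compl [ProperSpace V] (ha : 0 ≤ a) {g : V → F} (hg : SmoothDecay a g)
    (hf : ContDiff ℝ ∞ f) {ρ : ℝ} (h : ∀ x, ρ < ‖x‖ → f x = g x) : SmoothDecay a f := by
  refine ⟨hf, fun n => ?_⟩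
  obtain ⟨C, hC, hCb⟩ := hg.bound n
  obtain ⟨M, hM⟩ := (isCompact_closedBall (0 : V) ρ).exists_bound_of_continuousOn
    (hf.continuous_iteratedFDeriv (m := n) (by exact_mod_cast le_top)).continuousOn
  have hM0 : 0 ≤ max M 0 := le_max_right _ _
  refine ⟨C + max M 0 * (1 + |ρ|) ^ a, fun x => ?_⟩
  rcases le_or_gt ‖x‖ ρ with hx | hx
  · have h1 : 1 ≤ (1 + |ρ|) ^ a * (1 + ‖x‖) ^ (-a) := by
      rw [Real.rpow_neg (by positivity), ← div_eq_mul_inv, one_le_div (by positivity)]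
      gcongr
      exact hx.trans (le_abs_self _)
    calc ‖iteratedFDeriv ℝ n f x‖ ≤ max M 0 * 1 := by
          rw [mul_one]; exact (hM x (by simpa using hx)).trans (le_max_left _ _)
      _ ≤ max M 0 * ((1 + |ρ|) ^ a * (1 + ‖x‖) ^ (-a)) := by gcongr
      _ ≤ _ := by
        have : 0 ≤ C * (1 + ‖x‖) ^ (-a) := by positivity
        linarith
  · have : f =ᶠ[nhds x] g := by
      filter_upwards [(isOpen_lt continuous_const continuous_norm).mem_nhds hx] with y hy
      exact h y hy
    rw [(this.iteratedFDeriv ℝ n).eq_of_nhds]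
    refine (hCb x).trans ?_
    gcongr
    have : 0 ≤ max M 0 * (1 + |ρ|) ^ a := by positivity
    linarith

end

section
variable {V F : Type*} [NormedAddCommGroup V] [NormedSpace ℝ V] [MeasurableSpace V] [BorelSpace V]
    [SecondCountableTopology V] [NormedAddCommGroup F] [NormedSpace ℝ F] {a : ℝ}
    {μ : Measure V} {K : V → F} {u : V → ℝ}

theorem SmoothDecay.integrable_smul_sub (hK : SmoothDecay a K) (ha : 0 ≤ a)
    (hum : AEStronglyMeasurable u μ) (hu : Integrable (fun y => |u y| * (1 + ‖y‖) ^ (-a)) μ)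
    (x : V) : Integrable (fun y => u y • K (x - y)) μ := by
  obtain ⟨C, hC, h⟩ := hK.norm_le
  refine (hu.const_mul (C * (1 + ‖x‖) ^ a)).mono' (hum.smul
    (hK.1.continuous.comp (by fun_prop)).aestronglyMeasurable)
    (Filter.Eventually.of_forall fun y => ?_)
  rw [norm_smul, Real.norm_eq_abs]
  calc |u y| * ‖K (x - y)‖ ≤ |u y| * (C * (1 + ‖x - y‖) ^ (-a)) := by gcongr; exact h _
    _ ≤ |u y| * (C * ((1 + ‖x‖) ^ a * (1 + ‖y‖) ^ (-a))) := by
      gcongr; exact one_add_norm_rpow_neg_le ha x y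
    _ = _ := by ring

variable [CompleteSpace F]

/-- The convolution of a kernel of class `SmoothDecay a` with a function that is integrable
against `(1 + ‖y‖)^(-a)` is smooth, and its derivatives fall on the kernel. -/
theorem SmoothDecay.contDiff_integral (hK : SmoothDecay a K) (ha : 0 ≤ a)
    (hum : AEStronglyMeasurable u μ) (hu : Integrable (fun y => |u y| * (1 + ‖y‖) ^ (-a)) μ) :
    ContDiff ℝ ∞ (fun x => ∫ y, u y • K (x - y) ∂μ) ∧
      ∀ (n : ℕ) (C : ℝ), (∀ x, ‖iteratedFDeriv ℝ n K x‖ ≤ C * (1 + ‖x‖) ^ (-a)) → ∀ x,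
        ‖iteratedFDeriv ℝ n (fun x => ∫ y, u y • K (x - y) ∂μ) x‖ ≤
          C * ∫ y, |u y| * (1 + ‖x - y‖) ^ (-a) ∂μ := by
  have hd : ∀ y, ContDiff ℝ ∞ (fun x => K (x - y)) := fun y =>
    hK.1.comp (contDiff_id.sub contDiff_const)
  have hder : ∀ (n : ℕ) x y, iteratedFDeriv ℝ n (fun x => u y • K (x - y)) x =
      u y • iteratedFDeriv ℝ n K (x - y) := by
    intro n x y
    rw [iteratedFDeriv_const_smul_apply' (((hd y).of_le (by exact_mod_cast le_top)).contDiffAt),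
      iteratedFDeriv_comp_sub]
  have hT := hasFTaylorSeriesUpTo_integral (μ := μ) (f := fun y x => u y • K (x - y))
    (fun y => (hd y).const_smul _)
    (by
      intro n x
      simp_rw [hder]
      refine hum.smul (Continuous.aestronglyMeasurable ?_)
      exact (hK.1.continuous_iteratedFDeriv (m := n) (by exact_mod_cast le_top)).comp
        (by fun_prop))
    (by
      intro n x₀
      obtain ⟨C, hC, h⟩ := hK.bound n
      refine ⟨1, one_pos, fun y => C * (2 + ‖x₀‖) ^ a * (|u y| * (1 + ‖y‖) ^ (-a)),
        hu.const_mul _, Filter.Eventually.of_forall fun y x hx => ?_⟩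
      have hx' : ‖x‖ ≤ 1 + ‖x₀‖ := by
        have h1 : ‖x - x₀‖ < 1 := by simpa [dist_eq_norm] using hx
        have h2 : ‖x‖ ≤ ‖x - x₀‖ + ‖x₀‖ := by simpa using norm_add_le (x - x₀) x₀
        linarith
      rw [hder, norm_smul, Real.norm_eq_abs]
      calc |u y| * ‖iteratedFDeriv ℝ n K (x - y)‖ ≤ |u y| * (C * (1 + ‖x - y‖) ^ (-a)) := by
            gcongr; exact h _
        _ ≤ |u y| * (C * ((1 + ‖x‖) ^ a * (1 + ‖y‖) ^ (-a))) := by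
          gcongr; exact one_add_norm_rpow_neg_le ha x y
        _ ≤ |u y| * (C * ((2 + ‖x₀‖) ^ a * (1 + ‖y‖) ^ (-a))) := by
          gcongr ?_ * (C * (?_ ^ a * _))
          linarith
        _ = _ := by ring)
  refine ⟨hT.contDiff, fun n C hC x => ?_⟩
  rw [← hT.eq_iteratedFDeriv (by exact_mod_cast le_top)]
  rw [← integral_const_mul]
  refine norm_integral_le_of_norm_le
    ((integrable_mul_one_add_norm_sub ha hum hu x).const_mul C)
    (Filter.Eventually.of_forall fun y => ?_)
  rw [hder, norm_smul, Real.norm_eq_abs, mul_left_comm]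
  gcongr
  exact hC _

/-- Convolution with an integrable function supported in the unit ball preserves the class
`SmoothDecay a`. -/
theorem SmoothDecay.integral_smul_sub (hK : SmoothDecay a K) (ha : 0 ≤ a)
    (hu : Integrable u μ) (hu1 : ∀ y, 1 < ‖y‖ → u y = 0) :
    SmoothDecay a (fun x => ∫ y, u y • K (x - y) ∂μ) := by
  have hle : ∀ x y : V, |u y| * (1 + ‖x - y‖) ^ (-a) ≤
      2 ^ a * (1 + ‖x‖) ^ (-a) * |u y| := by
    intro x y
    rcases le_or_gt ‖y‖ 1 with hy | hy
    · rw [mul_comm]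
      gcongr
      have := one_add_norm_rpow_neg_le ha (-y) (-x)
      rw [show -y - -x = x - y by abel, norm_neg, norm_neg] at this
      refine this.trans ?_
      gcongr
      linarith
    · simp [hu1 y hy]
  have hu' : Integrable (fun y => |u y| * (1 + ‖y‖) ^ (-a)) μ := by
    refine (hu.abs.const_mul (2 ^ a * (1 + ‖(0 : V)‖) ^ (-a))).mono'
      (hu.aestronglyMeasurable.norm.mul ?_) (Filter.Eventually.of_forall fun y => ?_)
    · have : Continuous (fun y : V => (1 + ‖y‖) ^ (-a)) :=
        Continuous.rpow_const (by fun_prop) (fun y => Or.inl (by positivity))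
      exact this.aestronglyMeasurable
    · rw [Real.norm_of_nonneg (by positivity)]
      simpa using hle 0 y
  obtain ⟨h1, h2⟩ := hK.contDiff_integral ha hu.aestronglyMeasurable hu'
  refine ⟨h1, fun n => ?_⟩
  obtain ⟨C, hC, hb⟩ := hK.bound n
  refine ⟨C * (2 ^ a * ∫ y, |u y| ∂μ), fun x => (h2 n C hb x).trans ?_⟩
  calc C * ∫ y, |u y| * (1 + ‖x - y‖) ^ (-a) ∂μ
      ≤ C * ∫ y, 2 ^ a * (1 + ‖x‖) ^ (-a) * |u y| ∂μ := by
        gcongr ?_ * ?_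
        exact integral_mono (integrable_mul_one_add_norm_sub ha hu.aestronglyMeasurable hu' x)
          (hu.abs.const_mul _) (hle x)
    _ = _ := by rw [integral_const_mul]; ring
end

/-! ### A compactly supported function with radial Fourier transform -/

theorem contDiff_partialDeriv {d : ℕ} (i : Fin d) {f : EuclideanSpace ℝ (Fin d) → ℝ}
    (hf : ContDiff ℝ ∞ f) : ContDiff ℝ ∞ (partialDeriv i f) := by
  have : ContDiff ℝ ∞ (fderiv ℝ f) := hf.fderiv_right (by norm_cast)
  exact this.clm_apply contDiff_const

theorem partialDeriv_eq_zero {d : ℕ} (i : Fin d) {f : EuclideanSpace ℝ (Fin d) → ℝ} {ρ : ℝ}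
    (hf : ∀ x, ρ < ‖x‖ → f x = 0) (x) (hx : ρ < ‖x‖) : partialDeriv i f x = 0 := by
  have : f =ᶠ[𝓝 x] fun _ => 0 := by
    filter_upwards [(isOpen_lt continuous_const continuous_norm).mem_nhds hx] with y hy
    exact hf y hy
  simp [partialDeriv, this.fderiv_eq]

theorem hasCompactSupport_of_norm {V F : Type*} [NormedAddCommGroup V] [ProperSpace V] [Zero F]
    {f : V → F} {ρ : ℝ} (hf : ∀ x, ρ < ‖x‖ → f x = 0) : HasCompactSupport f :=
  HasCompactSupport.intro (isCompact_closedBall 0 ρ) fun x hx => hf x (by simpa using hx)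

theorem fourier_partialDeriv {d : ℕ} (i : Fin d) {f : EuclideanSpace ℝ (Fin d) → ℝ}
    (hf : ContDiff ℝ ∞ f) (hc : HasCompactSupport f) (ξ : EuclideanSpace ℝ (Fin d)) :
    𝓕 (fun x => (partialDeriv i f x : ℂ)) ξ =
      2 * Real.pi * Complex.I * ξ i * 𝓕 (fun x => (f x : ℂ)) ξ := by
  set g : EuclideanSpace ℝ (Fin d) → ℂ := fun x => (f x : ℂ) with hg
  have hgd : ContDiff ℝ ∞ g := Complex.ofRealCLM.contDiff.comp hf
  have hgc : HasCompactSupport g := hc.comp_left (g := fun r : ℝ => (r : ℂ)) Complex.ofReal_zero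
  have hi1 : Integrable (fderiv ℝ g) :=
    (hgd.continuous_fderiv (by norm_cast)).integrable_of_hasCompactSupport (hgc.fderiv ℝ)
  have h1 := Real.fourier_fderiv (hgd.continuous.integrable_of_hasCompactSupport hgc)
    (hgd.differentiable (by norm_cast)) hi1
  have h2 : (fun x => (partialDeriv i f x : ℂ)) =
      fun x => fderiv ℝ g x (EuclideanSpace.single i 1) := by
    ext x
    have : HasFDerivAt g (Complex.ofRealCLM.comp (fderiv ℝ f x)) x :=
      Complex.ofRealCLM.hasFDerivAt.comp x
        ((hf.differentiable (by norm_cast)) x).hasFDerivAt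
    rw [this.fderiv]
    rfl
  rw [h2, ← Real.fourier_continuousLinearMap_apply hi1, h1]
  have h3 : innerSL ℝ ξ (EuclideanSpace.single i 1) = ξ i := by
    rw [innerSL_apply_apply, EuclideanSpace.inner_single_right]
    simp
  simp [VectorFourier.fourierSMulRight_apply, h3]
  ring

/-- The operator `-Δ` on smooth functions. -/
noncomputable def negLaplacian {d : ℕ} (f : EuclideanSpace ℝ (Fin d) → ℝ) :
    EuclideanSpace ℝ (Fin d) → ℝ :=
  fun x => -∑ i, partialDeriv i (partialDeriv i f) x

theorem contDiff_negLaplacian {d : ℕ} {f : EuclideanSpace ℝ (Fin d) → ℝ}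
    (hf : ContDiff ℝ ∞ f) : ContDiff ℝ ∞ (negLaplacian f) :=
  (ContDiff.sum fun i _ => contDiff_partialDeriv i (contDiff_partialDeriv i hf)).neg

theorem negLaplacian_eq_zero {d : ℕ} {f : EuclideanSpace ℝ (Fin d) → ℝ} {ρ : ℝ}
    (hf : ∀ x, ρ < ‖x‖ → f x = 0) (x) (hx : ρ < ‖x‖) : negLaplacian f x = 0 := by
  simp only [negLaplacian, neg_eq_zero]
  exact Finset.sum_eq_zero fun i _ =>
    partialDeriv_eq_zero i (partialDeriv_eq_zero i hf) x hx

theorem fourier_negLaplacian {d : ℕ} {f : EuclideanSpace ℝ (Fin d) → ℝ} {ρ : ℝ}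
    (hf : ContDiff ℝ ∞ f) (hc : ∀ x, ρ < ‖x‖ → f x = 0) (ξ : EuclideanSpace ℝ (Fin d)) :
    𝓕 (fun x => (negLaplacian f x : ℂ)) ξ =
      ((2 * Real.pi * ‖ξ‖) ^ 2 : ℝ) * 𝓕 (fun x => (f x : ℂ)) ξ := by
  have h1 : ∀ i, 𝓕 (fun x => (partialDeriv i (partialDeriv i f) x : ℂ)) ξ =
      -((2 * Real.pi) ^ 2 * ξ i ^ 2 : ℝ) * 𝓕 (fun x => (f x : ℂ)) ξ := by
    intro i
    rw [fourier_partialDeriv i (contDiff_partialDeriv i hf)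
      (hasCompactSupport_of_norm (partialDeriv_eq_zero i hc)),
      fourier_partialDeriv i hf (hasCompactSupport_of_norm hc)]
    push_cast
    linear_combination (2 * Real.pi) ^ 2 * (ξ i : ℂ) ^ 2 * 𝓕 (fun x => (f x : ℂ)) ξ * Complex.I_sq
  have hint : ∀ i, Integrable (fun x => (partialDeriv i (partialDeriv i f) x : ℂ)) := fun i =>
    (Continuous.integrable_of_hasCompactSupport
      (contDiff_partialDeriv i (contDiff_partialDeriv i hf)).continuous
      (hasCompactSupport_of_norm (partialDeriv_eq_zero i (partialDeriv_eq_zero i hc)))).ofReal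
  have h2 : 𝓕 (fun x => (negLaplacian f x : ℂ)) ξ =
      -∑ i, 𝓕 (fun x => (partialDeriv i (partialDeriv i f) x : ℂ)) ξ := by
    simp only [Real.fourier_eq, negLaplacian]
    rw [← integral_finsetSum, ← integral_neg]
    · congr 1
      ext x
      push_cast
      rw [smul_neg, Finset.smul_sum]
    · intro i _
      exact (Real.fourierIntegral_convergent_iff ξ).2 (hint i)
  rw [h2]
  simp_rw [h1]
  rw [← Finset.sum_mul, Finset.sum_neg_distrib, neg_mul, neg_neg, mul_pow _ ‖ξ‖,
    EuclideanSpace.real_norm_sq_eq, Finset.mul_sum]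
  push_cast
  rfl

/-- `G` is a smooth function supported in the closed unit ball whose Fourier transform is radial
with radial part `γ ≥ 0`, vanishes to order `p` at the origin but not identically near it, and
decays rapidly. -/
structure IsRadialProfile {d : ℕ} (p : ℕ) (G : EuclideanSpace ℝ (Fin d) → ℝ) (γ : ℝ → ℝ) :
    Prop where
  contDiff : ContDiff ℝ ∞ G
  eq_zero : ∀ x, 1 < ‖x‖ → G x = 0
  fourier : ∀ ξ, 𝓕 (fun x => (G x : ℂ)) ξ = γ ‖ξ‖
  continuous : Continuous γ
  nonneg : ∀ r, 0 ≤ r → 0 ≤ γ r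
  small : ∃ C, ∀ r, 0 ≤ r → γ r ≤ C * r ^ p
  rapid : ∀ k : ℕ, ∃ C, ∀ r, 0 ≤ r → r ^ k * γ r ≤ C
  pos : ∃ ε > 0, ∀ r, 0 < r → r < ε → 0 < γ r

/-- The Fourier transform of a radial function is radial: two vectors of equal norm are exchanged
by a reflection. -/
theorem fourier_eq_of_norm_eq {d : ℕ} {f : EuclideanSpace ℝ (Fin d) → ℂ}
    (hf : ∀ x y, ‖x‖ = ‖y‖ → f x = f y) {ξ η : EuclideanSpace ℝ (Fin d)} (h : ‖ξ‖ = ‖η‖) :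
    𝓕 f ξ = 𝓕 f η := by
  let A := (Submodule.span ℝ {ξ - η})ᗮ.reflection
  have hA : A ξ = η := Submodule.reflection_sub h
  have hfA : f ∘ A = f := funext fun x => hf _ _ (by simp)
  rw [← hA, ← Real.fourier_comp_linearIsometry, hfA]

theorem im_fourier_eq_zero {d : ℕ} {f : EuclideanSpace ℝ (Fin d) → ℝ}
    (hf : ∀ x y, ‖x‖ = ‖y‖ → f x = f y) (ξ : EuclideanSpace ℝ (Fin d)) :
    (𝓕 (fun x => (f x : ℂ)) ξ).im = 0 := by
  rw [← Complex.conj_eq_iff_im]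
  have h1 : 𝓕 (fun x => (f x : ℂ)) (-ξ) = 𝓕 (fun x => (f x : ℂ)) ξ :=
    fourier_eq_of_norm_eq (fun x y h => by rw [hf x y h]) (by simp)
  rw [← h1]
  nth_rw 1 [h1]
  rw [Real.fourier_eq', Real.fourier_eq', ← integral_conj]
  congr 1
  ext x
  simp [← Complex.exp_conj, map_ofNat]

theorem ofReal_integral_mul_sub {d : ℕ} (f g : EuclideanSpace ℝ (Fin d) → ℝ) :
    (fun x => ((∫ y, f y * g (x - y) : ℝ) : ℂ)) = convolution (fun x => (f x : ℂ))
      (fun x => (g x : ℂ)) (ContinuousLinearMap.lsmul ℂ ℂ) volume := by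
  ext x
  rw [convolution_def, ← integral_complex_ofReal]
  simp

theorem fourier_ofReal_convolution {d : ℕ} {f g : EuclideanSpace ℝ (Fin d) → ℝ}
    (hf : Integrable f) (hg : Integrable g) (ξ : EuclideanSpace ℝ (Fin d)) :
    𝓕 (fun x => ((∫ y, f y * g (x - y) : ℝ) : ℂ)) ξ =
      𝓕 (fun x => (f x : ℂ)) ξ * 𝓕 (fun x => (g x : ℂ)) ξ := by
  rw [ofReal_integral_mul_sub]
  exact Real.fourier_smul_convolution_eq hf.ofReal hg.ofReal ξ

/-- For a radial bump function `b`, the function `G = (-Δ)^m (b ⋆ b)` has the Fourier transform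
`(2π‖ξ‖)^(2m) (𝓕 b)²`, where `𝓕 b` is real because `b` is even. -/
theorem exists_isRadialProfile {d : ℕ} (hd : 0 < d) (m : ℕ) :
    ∃ (G : EuclideanSpace ℝ (Fin d) → ℝ) (γ : ℝ → ℝ), IsRadialProfile (2 * m) G γ := by
  let b : EuclideanSpace ℝ (Fin d) → ℝ := fun x => expNegInvGlue (1 / 4 - ‖x‖ ^ 2)
  have hb : ContDiff ℝ ∞ b := expNegInvGlue.contDiff.comp (contDiff_const.sub (contDiff_norm_sq ℝ))
  have hb0 : ∀ x, 1 / 2 < ‖x‖ → b x = 0 := by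
    intro x hx
    apply expNegInvGlue.zero_of_nonpos
    nlinarith
  have hbc : HasCompactSupport b := hasCompactSupport_of_norm hb0
  have hbi : Integrable b := hb.continuous.integrable_of_hasCompactSupport hbc
  have hbr : ∀ x y, ‖x‖ = ‖y‖ → b x = b y := fun x y h => by simp [b, h]
  let e : EuclideanSpace ℝ (Fin d) := EuclideanSpace.single ⟨0, hd⟩ 1
  have he : ‖e‖ = 1 := by simp [e]
  let β : ℝ → ℝ := fun r => (𝓕 (fun x => (b x : ℂ)) (r • e)).re
  have hβc : Continuous β := by
    have : Continuous (𝓕 (fun x => (b x : ℂ))) :=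
      VectorFourier.fourierIntegral_continuous Real.continuous_fourierChar
        (innerSL ℝ).continuous₂ hbi.ofReal
    fun_prop
  have hβ : ∀ ξ, 𝓕 (fun x => (b x : ℂ)) ξ = β ‖ξ‖ := by
    intro ξ
    have h1 : 𝓕 (fun x => (b x : ℂ)) ξ = 𝓕 (fun x => (b x : ℂ)) (‖ξ‖ • e) :=
      fourier_eq_of_norm_eq (fun x y h => by rw [hbr x y h]) (by simp [norm_smul, he])
    rw [h1]
    apply Complex.ext
    · simp [β]
    · simp [im_fourier_eq_zero hbr]
  have hβ0 : 0 < β 0 := by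
    have h1 : (β 0 : ℂ) = ((∫ x, b x : ℝ) : ℂ) := by
      have := hβ 0
      rw [norm_zero] at this
      rw [← this, Real.fourier_eq']
      simpa using integral_complex_ofReal
    rw [Complex.ofReal_inj.1 h1]
    refine hb.continuous.integral_pos_of_hasCompactSupport_nonneg_nonzero hbc
      (fun x => expNegInvGlue.nonneg _) (x := 0) ?_
    exact (expNegInvGlue.pos_of_pos (by norm_num)).ne'
  let g : EuclideanSpace ℝ (Fin d) → ℝ := fun x => ∫ y, b y * b (x - y)
  have hg : ContDiff ℝ ∞ g := hbc.contDiff_convolution_right (ContinuousLinearMap.lsmul ℝ ℝ) hbi.locallyIntegrable hb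
  have hg0 : ∀ x, 1 < ‖x‖ → g x = 0 := by
    intro x hx
    by_contra hne
    obtain ⟨y, hy, z, hz, rfl⟩ := support_convolution_subset (ContinuousLinearMap.lsmul ℝ ℝ) hne
    have hy' : ‖y‖ ≤ 1 / 2 := not_lt.1 fun h => hy (hb0 y h)
    have hz' : ‖z‖ ≤ 1 / 2 := not_lt.1 fun h => hz (hb0 z h)
    have := norm_add_le y z
    simp only at hx
    linarith
  have hgf : ∀ ξ, 𝓕 (fun x => (g x : ℂ)) ξ = (β ‖ξ‖ ^ 2 : ℝ) := by
    intro ξ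
    rw [fourier_ofReal_convolution hbi hbi, hβ]
    push_cast
    ring
  have hind : ∀ m : ℕ, ContDiff ℝ ∞ (negLaplacian^[m] g) ∧
      (∀ x, 1 < ‖x‖ → negLaplacian^[m] g x = 0) ∧
      ∀ ξ, 𝓕 (fun x => (negLaplacian^[m] g x : ℂ)) ξ =
        ((2 * Real.pi * ‖ξ‖) ^ (2 * m) * β ‖ξ‖ ^ 2 : ℝ) := by
    intro m
    induction m with
    | zero => exact ⟨hg, hg0, fun ξ => by simpa using hgf ξ⟩
    | succ m ih =>
      simp only [Function.iterate_succ_apply']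
      refine ⟨contDiff_negLaplacian ih.1, negLaplacian_eq_zero ih.2.1, fun ξ => ?_⟩
      rw [fourier_negLaplacian ih.1 ih.2.1, ih.2.2]
      push_cast
      ring
  obtain ⟨h1, h2, h3⟩ := hind m
  refine ⟨negLaplacian^[m] g, fun r => (2 * Real.pi * r) ^ (2 * m) * β r ^ 2, h1, h2, h3,
    by fun_prop, fun r hr => by positivity, ?_, ?_, ?_⟩
  · refine ⟨(2 * Real.pi) ^ (2 * m) * (∫ x, ‖b x‖) ^ 2, fun r hr => ?_⟩
    have : |β r| ≤ ∫ x, ‖b x‖ := by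
      refine (Complex.abs_re_le_norm _).trans ?_
      refine (VectorFourier.norm_fourierIntegral_le_integral_norm _ _ _ _ _).trans ?_
      simp
    rw [mul_pow, mul_right_comm]
    have h4 : β r ^ 2 ≤ (∫ x, ‖b x‖) ^ 2 := by
      rw [← sq_abs]
      gcongr
    gcongr
  · intro k
    let S : SchwartzMap (EuclideanSpace ℝ (Fin d)) ℂ :=
      HasCompactSupport.toSchwartzMap (f := fun x => (negLaplacian^[m] g x : ℂ))
        ((hasCompactSupport_of_norm h2).comp_left (g := fun r : ℝ => (r : ℂ)) Complex.ofReal_zero)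
        (Complex.ofRealCLM.contDiff.comp h1)
    obtain ⟨C, hC⟩ := (𝓕 S).decay k 0
    refine ⟨C, fun r hr => ?_⟩
    have h4 := hC.2 (r • e)
    rw [norm_iteratedFDeriv_zero, SchwartzMap.fourier_coe] at h4
    have h5 := h3 (r • e)
    have h6 : (S : EuclideanSpace ℝ (Fin d) → ℂ) = fun x => (negLaplacian^[m] g x : ℂ) := rfl
    rw [h6, h5] at h4
    rw [norm_smul, he, mul_one, Real.norm_of_nonneg hr, Complex.norm_real,
      Real.norm_of_nonneg (by positivity)] at h4
    exact h4
  · have := (hβc.tendsto 0).eventually (lt_mem_nhds hβ0)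
    obtain ⟨ε, hε, h⟩ := Metric.eventually_nhds_iff.1 this
    refine ⟨ε, hε, fun r hr hr' => ?_⟩
    have : 0 < β r := h (by simpa [abs_of_pos hr] using hr')
    positivity

/-! ### Averages of dilations -/

section
variable {d p : ℕ} {G : EuclideanSpace ℝ (Fin d) → ℝ} {γ : ℝ → ℝ}

theorem IsRadialProfile.rapid' (h : IsRadialProfile p G γ) (k : ℕ) :
    ∃ C, 0 < C ∧ ∀ r, 0 < r → γ r ≤ C * r ^ (-(k : ℝ)) := by
  obtain ⟨C, hC⟩ := h.rapid k
  refine ⟨max C 1, by positivity, fun r hr => ?_⟩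
  rw [Real.rpow_neg hr.le, Real.rpow_natCast, ← div_eq_mul_inv, le_div_iff₀ (by positivity),
    mul_comm]
  exact (hC r hr.le).trans (le_max_left _ _)

theorem IsRadialProfile.aestronglyMeasurable (h : IsRadialProfile p G γ) (q ρ : ℝ)
    (μ : Measure ℝ) : AEStronglyMeasurable (fun t => t ^ q * γ (t * ρ)) μ := by
  have := h.continuous.measurable
  exact (by fun_prop : Measurable (fun t => t ^ q * γ (t * ρ))).aestronglyMeasurable

/-- The order of vanishing `p` gives integrability at `0`, the rapid decay gives it at `∞`. -/
theorem IsRadialProfile.integrableOn (h : IsRadialProfile p G γ) {q : ℝ} (hq : -1 < q + p) :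
    IntegrableOn (fun t => t ^ q * γ t) (Set.Ioi 0) := by
  have hm : ∀ μ : Measure ℝ, AEStronglyMeasurable (fun t => t ^ q * γ t) μ := fun μ => by
    simpa using h.aestronglyMeasurable q 1 μ
  rw [← Set.Ioc_union_Ioi_eq_Ioi (zero_le_one' ℝ), integrableOn_union]
  constructor
  · obtain ⟨C, hC⟩ := h.small
    have hI : IntegrableOn (fun t : ℝ => C * t ^ (q + p)) (Set.Ioc 0 1) := by
      refine Integrable.const_mul ?_ C
      have := intervalIntegral.intervalIntegrable_rpow' (a := 0) (b := 1) hq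
      rwa [intervalIntegrable_iff_integrableOn_Ioc_of_le zero_le_one] at this
    refine Integrable.mono' hI (hm _) ?_
    filter_upwards [ae_restrict_mem measurableSet_Ioc] with t ht
    have h0 : 0 < t := ht.1
    rw [Real.norm_of_nonneg (mul_nonneg (by positivity) (h.nonneg t h0.le)), Real.rpow_add h0,
      Real.rpow_natCast]
    calc t ^ q * γ t ≤ t ^ q * (C * t ^ p) := by gcongr; exact hC t h0.le
      _ = _ := by ring
  · obtain ⟨k, hk⟩ := exists_nat_gt (q + 1)
    obtain ⟨C, hC0, hC⟩ := h.rapid' k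
    have hI : IntegrableOn (fun t : ℝ => C * t ^ (q - k)) (Set.Ioi 1) :=
      (integrableOn_Ioi_rpow_of_lt (by linarith) one_pos).const_mul C
    refine Integrable.mono' hI (hm _) ?_
    filter_upwards [ae_restrict_mem measurableSet_Ioi] with t ht
    have h0 : 0 < t := one_pos.trans ht
    rw [Real.norm_of_nonneg (mul_nonneg (by positivity) (h.nonneg t h0.le)), sub_eq_add_neg,
      Real.rpow_add h0]
    calc t ^ q * γ t ≤ t ^ q * (C * t ^ (-(k : ℝ))) := by gcongr; exact hC t h0
      _ = _ := by ring

theorem IsRadialProfile.integral_pos (h : IsRadialProfile p G γ) {q : ℝ} (hq : -1 < q + p) :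
    0 < ∫ t in Set.Ioi 0, t ^ q * γ t := by
  rw [setIntegral_pos_iff_support_of_nonneg_ae _ (h.integrableOn hq)]
  · obtain ⟨ε, hε, hpos⟩ := h.pos
    have : Set.Ioo 0 ε ⊆ Function.support (fun t => t ^ q * γ t) ∩ Set.Ioi 0 := fun t ht =>
      ⟨(mul_pos (Real.rpow_pos_of_pos ht.1 _) (hpos t ht.1 ht.2)).ne', ht.1⟩
    refine lt_of_lt_of_le ?_ (measure_mono this)
    simpa using hε
  · filter_upwards [ae_restrict_mem measurableSet_Ioi] with t (ht : 0 < t)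
    exact mul_nonneg (by positivity) (h.nonneg t ht.le)

theorem IsRadialProfile.integrableOn_mul (h : IsRadialProfile p G γ) {q : ℝ} (hq : -1 < q + p)
    {ρ : ℝ} (hρ : 0 < ρ) : IntegrableOn (fun t => t ^ q * γ (t * ρ)) (Set.Ioi 0) := by
  have h1 := (integrableOn_Ioi_comp_mul_left_iff (fun t => t ^ q * γ t) 0 hρ).2
    (by simpa using h.integrableOn hq)
  refine (h1.const_mul (ρ ^ (-q))).congr ?_
  filter_upwards [ae_restrict_mem measurableSet_Ioi] with t (ht : 0 < t)
  rw [Real.mul_rpow hρ.le ht.le, Real.rpow_neg hρ.le, mul_comm t ρ]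
  field_simp

theorem integral_Ioi_rpow_mul_comp_mul (γ : ℝ → ℝ) (q : ℝ) {ρ : ℝ} (hρ : 0 < ρ) : ∫ t in Set.Ioi 0, t ^ q * γ (t * ρ) =
      ρ ^ (-q - 1) * ∫ t in Set.Ioi 0, t ^ q * γ t := by
  have h1 := integral_comp_mul_left_Ioi (fun t => t ^ q * γ t) 0 hρ
  rw [mul_zero, smul_eq_mul] at h1
  have h2 : ρ ^ (-q - 1) = ρ ^ (-q) * ρ⁻¹ := by
    rw [Real.rpow_sub hρ, Real.rpow_one]; rfl
  rw [h2, mul_assoc, ← h1, ← integral_const_mul]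
  refine setIntegral_congr_fun measurableSet_Ioi fun t (ht : 0 < t) => ?_
  rw [Real.mul_rpow hρ.le ht.le, Real.rpow_neg hρ.le, mul_comm t ρ]
  field_simp

theorem IsRadialProfile.tail_le (h : IsRadialProfile p G γ) {q δ : ℝ} (hδ : 0 < δ) (k : ℕ)
    (hk : q + 1 < k) : ∃ C, 0 < C ∧ ∀ ρ, 0 < ρ →
      |∫ t in Set.Ioi δ, t ^ q * γ (t * ρ)| ≤ C * ρ ^ (-(k : ℝ)) := by
  obtain ⟨C, hC0, hC⟩ := h.rapid' k
  have hI : IntegrableOn (fun t : ℝ => t ^ (q - k)) (Set.Ioi δ) :=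
      (integrableOn_Ioi_rpow_of_lt (by linarith) hδ)
  have hI0 : 0 ≤ ∫ t in Set.Ioi δ, t ^ (q - k) :=
    setIntegral_nonneg measurableSet_Ioi fun t ht => Real.rpow_nonneg (hδ.trans ht).le _
  refine ⟨C * ((∫ t in Set.Ioi δ, t ^ (q - k)) + 1), by positivity, fun ρ hρ => ?_⟩
  calc |∫ t in Set.Ioi δ, t ^ q * γ (t * ρ)|
      ≤ ∫ t in Set.Ioi δ, C * ρ ^ (-(k : ℝ)) * t ^ (q - k) := by
        rw [← Real.norm_eq_abs]
        refine norm_integral_le_of_norm_le (hI.const_mul _) ?_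
        filter_upwards [ae_restrict_mem measurableSet_Ioi] with t ht
        have h0 : 0 < t := hδ.trans ht
        rw [Real.norm_of_nonneg (mul_nonneg (by positivity) (h.nonneg _ (by positivity))),
          sub_eq_add_neg, Real.rpow_add h0]
        calc t ^ q * γ (t * ρ) ≤ t ^ q * (C * (t * ρ) ^ (-(k : ℝ))) := by
              gcongr; exact hC _ (by positivity)
          _ = _ := by rw [Real.mul_rpow h0.le hρ.le]; ring
    _ = C * ρ ^ (-(k : ℝ)) * ∫ t in Set.Ioi δ, t ^ (q - k) := integral_const_mul _ _
    _ ≤ _ := by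
      rw [mul_right_comm]
      gcongr
      linarith

end

/-- The superposition `∫_S w(t) t^(-d) G(x / t) dt` of the `L¹`-normalised dilates of `G`. -/
noncomputable def dilationAverage {d : ℕ} (w : ℝ → ℝ) (S : Set ℝ)
    (G : EuclideanSpace ℝ (Fin d) → ℝ) (x : EuclideanSpace ℝ (Fin d)) : ℝ :=
  ∫ t in S, w t * ((t ^ d)⁻¹ * G (t⁻¹ • x))

section
variable {d : ℕ} {G : EuclideanSpace ℝ (Fin d) → ℝ}

theorem integral_dilate {F : Type*} [NormedAddCommGroup F] [NormedSpace ℝ F]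
    (f : EuclideanSpace ℝ (Fin d) → F) {t : ℝ} (ht : 0 < t) :
    ∫ x, (t ^ d)⁻¹ • f (t⁻¹ • x) = ∫ x, f x := by
  rw [integral_smul, Measure.integral_comp_inv_smul_of_nonneg _ _ ht.le, smul_smul,
    finrank_euclideanSpace_fin, inv_mul_cancel₀ (by positivity), one_smul]

theorem integrable_dilate (hG : Integrable G) {t : ℝ} (ht : 0 < t) :
    Integrable (fun x => (t ^ d)⁻¹ * G (t⁻¹ • x)) :=
  (hG.comp_smul (inv_ne_zero ht.ne')).const_mul _

theorem fourier_dilate (G : EuclideanSpace ℝ (Fin d) → ℝ) {t : ℝ} (ht : 0 < t)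
    (ξ : EuclideanSpace ℝ (Fin d)) :
    𝓕 (fun x => (((t ^ d)⁻¹ * G (t⁻¹ • x) : ℝ) : ℂ)) ξ =
      𝓕 (fun x => (G x : ℂ)) (t • ξ) := by
  rw [Real.fourier_eq, Real.fourier_eq,
    ← integral_dilate (fun x => Real.fourierChar (-inner ℝ x (t • ξ)) • (G x : ℂ)) ht]
  congr 1
  ext x
  rw [real_inner_smul_left, real_inner_smul_right, inv_mul_cancel_left₀ ht.ne', smul_comm]
  congr 1
  push_cast
  rw [Complex.real_smul]
  push_cast
  rfl

variable {w : ℝ → ℝ} {S : Set ℝ}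

theorem integrable_prod_dilate (hG : Continuous G) (hGi : Integrable G) (hS : MeasurableSet S)
    (hS0 : S ⊆ Set.Ioi 0) (hw : IntegrableOn w S) :
    Integrable (fun z : ℝ × EuclideanSpace ℝ (Fin d) =>
      w z.1 * ((z.1 ^ d)⁻¹ * G (z.1⁻¹ • z.2))) ((volume.restrict S).prod volume) := by
  have hm : AEStronglyMeasurable (fun z : ℝ × EuclideanSpace ℝ (Fin d) =>
      w z.1 * ((z.1 ^ d)⁻¹ * G (z.1⁻¹ • z.2))) ((volume.restrict S).prod volume) := by
    refine hw.aestronglyMeasurable.comp_fst.mul (Measurable.aestronglyMeasurable ?_)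
    have := hG.measurable
    fun_prop
  rw [integrable_prod_iff hm]
  constructor
  · filter_upwards [ae_restrict_mem hS] with t ht
    exact (integrable_dilate hGi (hS0 ht)).const_mul _
  · refine (hw.norm.mul_const (∫ x, ‖G x‖)).congr ?_
    filter_upwards [ae_restrict_mem hS] with t ht
    have h0 : 0 < t := hS0 ht
    simp_rw [norm_mul]
    rw [integral_const_mul]
    congr 1
    rw [← integral_dilate (fun x => ‖G x‖) h0]
    congr 1
    ext x
    simp [abs_of_pos h0]

theorem integrable_dilationAverage (hG : Continuous G) (hGi : Integrable G)
    (hS : MeasurableSet S) (hS0 : S ⊆ Set.Ioi 0) (hw : IntegrableOn w S) :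
    Integrable (dilationAverage w S G) :=
  (integrable_prod_dilate hG hGi hS hS0 hw).integral_prod_right

theorem fourier_dilationAverage (hG : Continuous G) (hGi : Integrable G)
    (hS : MeasurableSet S) (hS0 : S ⊆ Set.Ioi 0) (hw : IntegrableOn w S)
    (ξ : EuclideanSpace ℝ (Fin d)) :
    𝓕 (fun x => (dilationAverage w S G x : ℂ)) ξ =
      ∫ t in S, (w t : ℂ) * 𝓕 (fun x => (G x : ℂ)) (t • ξ) := by
  have hI := (integrable_prod_dilate hG hGi hS hS0 hw).ofReal (𝕜 := ℂ)
  have hI2 : Integrable (fun z : ℝ × EuclideanSpace ℝ (Fin d) =>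
      Real.fourierChar (-inner ℝ z.2 ξ) •
        ((w z.1 * ((z.1 ^ d)⁻¹ * G (z.1⁻¹ • z.2)) : ℝ) : ℂ))
      ((volume.restrict S).prod volume) := by
    refine hI.norm.mono' ?_ (Filter.Eventually.of_forall fun z => by simp)
    have hc : Continuous (fun z : ℝ × EuclideanSpace ℝ (Fin d) =>
      (Real.fourierChar (-inner ℝ z.2 ξ) : ℂ)) := by fun_prop
    exact hc.aestronglyMeasurable.smul hI.aestronglyMeasurable
  have h1 : 𝓕 (fun x => (dilationAverage w S G x : ℂ)) ξ =
      ∫ x, ∫ t in S, Real.fourierChar (-inner ℝ x ξ) •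
        ((w t * ((t ^ d)⁻¹ * G (t⁻¹ • x)) : ℝ) : ℂ) := by
    rw [Real.fourier_eq]
    congr 1
    ext x
    rw [dilationAverage, ← integral_complex_ofReal]
    simp only [Circle.smul_def]
    rw [integral_smul]
  rw [h1, integral_integral_swap (f := fun x t => Real.fourierChar (-inner ℝ x ξ) •
        ((w t * ((t ^ d)⁻¹ * G (t⁻¹ • x)) : ℝ) : ℂ)) hI2.swap]
  refine setIntegral_congr_fun hS fun t ht => ?_
  rw [← fourier_dilate G (hS0 ht), Real.fourier_eq, ← integral_const_mul]
  congr 1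
  ext x
  push_cast
  simp only [Circle.smul_def, smul_eq_mul]
  ring

theorem dilationAverage_eq_zero {δ : ℝ} (hS0 : S ⊆ Set.Ioc 0 δ)
    (hG : ∀ x, 1 < ‖x‖ → G x = 0) {x : EuclideanSpace ℝ (Fin d)} (hx : δ < ‖x‖) :
    dilationAverage w S G x = 0 := by
  refine setIntegral_eq_zero_of_forall_eq_zero fun t ht => ?_
  obtain ⟨h0, h1⟩ := hS0 ht
  rw [hG, mul_zero, mul_zero]
  rw [norm_smul, norm_inv, Real.norm_of_nonneg h0.le, inv_mul_eq_div, one_lt_div h0]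
  linarith

/-- Averaging the dilates of a smooth function supported in the unit ball over the scales `t > δ`
with the weight `t^(-b-1)` yields decay of order `d + b`: at the point `x` only the scales
`t ≥ ‖x‖` contribute. -/
theorem smoothDecay_dilationAverage (hG : ContDiff ℝ ∞ G) (hG0 : ∀ x, 1 < ‖x‖ → G x = 0)
    {c b δ : ℝ} (hb : 0 < b) (hδ : 0 < δ) (hδ1 : δ ≤ 1) :
    SmoothDecay (d + b) (dilationAverage (fun t => c * t ^ (-b - 1)) (Set.Ioi δ) G) := by
  have hcont : ∀ n : ℕ, Continuous (iteratedFDeriv ℝ n G) := fun n =>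
    hG.continuous_iteratedFDeriv (by exact_mod_cast le_top)
  have hsupp : ∀ (n : ℕ) x, 1 < ‖x‖ → iteratedFDeriv ℝ n G x = 0 := by
    intro n x hx
    have : G =ᶠ[𝓝 x] fun _ => 0 := by
      filter_upwards [(isOpen_lt continuous_const continuous_norm).mem_nhds hx] with y hy
      exact hG0 y hy
    rw [(this.iteratedFDeriv ℝ n).eq_of_nhds, iteratedFDeriv_fun_zero]
    rfl
  have hM : ∀ n : ℕ, ∃ M, 0 ≤ M ∧ ∀ x, ‖iteratedFDeriv ℝ n G x‖ ≤ M := by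
    intro n
    obtain ⟨M, hM⟩ := (hasCompactSupport_of_norm (hsupp n)).exists_bound_of_continuous (hcont n)
    exact ⟨M, (norm_nonneg _).trans (hM 0), hM⟩
  have hd : ∀ (n : ℕ) (t : ℝ) x, iteratedFDeriv ℝ n
      (fun x => c * t ^ (-b - 1) * ((t ^ d)⁻¹ * G (t⁻¹ • x))) x =
      (c * t ^ (-b - 1) * (t ^ d)⁻¹ * (t⁻¹) ^ n) • iteratedFDeriv ℝ n G (t⁻¹ • x) := by
    intro n t x
    have h1 : (fun x => c * t ^ (-b - 1) * ((t ^ d)⁻¹ * G (t⁻¹ • x))) =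
        fun x => (c * t ^ (-b - 1) * (t ^ d)⁻¹) • G (t⁻¹ • x) := by
      ext x; simp [mul_assoc]
    have hG' : ContDiff ℝ n G := hG.of_le (by exact_mod_cast le_top)
    have hGt : ContDiff ℝ n (fun x => G (t⁻¹ • x)) := by fun_prop
    rw [h1, iteratedFDeriv_const_smul_apply' hGt.contDiffAt,
      iteratedFDeriv_comp_const_smul _ hG', smul_smul]
  have hpow : ∀ (n : ℕ) (t : ℝ), δ < t →
      ‖c * t ^ (-b - 1) * (t ^ d)⁻¹ * (t⁻¹) ^ n‖ ≤ |c| * (δ⁻¹) ^ n * t ^ (-(d + b) - 1) := by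
    intro n t ht
    have h0 : 0 < t := hδ.trans ht
    have h1 : t ^ (-(d + b) - 1) = t ^ (-b - 1) * (t ^ d)⁻¹ := by
      rw [← Real.rpow_natCast, ← Real.rpow_neg h0.le, ← Real.rpow_add h0]
      congr 1; ring
    rw [h1]
    simp only [norm_mul, norm_inv, norm_pow, Real.norm_eq_abs, abs_of_pos h0,
      abs_of_pos (Real.rpow_pos_of_pos h0 _)]
    calc |c| * t ^ (-b - 1) * (t ^ d)⁻¹ * (t⁻¹) ^ n
        ≤ |c| * t ^ (-b - 1) * (t ^ d)⁻¹ * (δ⁻¹) ^ n := by gcongr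
      _ = _ := by ring
  have hda : (0 : ℝ) < d + b := by positivity
  have hI : ∀ μ : ℝ, 0 < μ → IntegrableOn (fun t : ℝ => t ^ (-(d + b) - 1)) (Set.Ioi μ) :=
    fun μ hμ => integrableOn_Ioi_rpow_of_lt (by linarith) hμ
  have hT := hasFTaylorSeriesUpTo_integral (μ := volume.restrict (Set.Ioi δ))
    (f := fun t x => c * t ^ (-b - 1) * ((t ^ d)⁻¹ * G (t⁻¹ • x)))
    (fun t => by fun_prop)
    (by
      intro n x
      simp_rw [hd]
      have hmw : Measurable fun t : ℝ => c * t ^ (-b - 1) * (t ^ d)⁻¹ * (t⁻¹) ^ n := by fun_prop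
      refine AEStronglyMeasurable.smul hmw.aestronglyMeasurable ?_
      have hmt : Measurable fun t : ℝ => t⁻¹ • x := by fun_prop
      exact (hcont n).comp_aestronglyMeasurable hmt.aestronglyMeasurable)
    (by
      intro n x₀
      obtain ⟨M, hM0, hM⟩ := hM n
      refine ⟨1, one_pos, fun t => |c| * (δ⁻¹) ^ n * t ^ (-(d + b) - 1) * M,
        ((hI δ hδ).const_mul _).mul_const M, ?_⟩
      filter_upwards [ae_restrict_mem measurableSet_Ioi] with t ht x _
      rw [hd, norm_smul]
      exact mul_le_mul (hpow n t ht) (hM _) (norm_nonneg _) ((norm_nonneg _).trans (hpow n t ht)))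
  refine ⟨hT.contDiff, fun n => ?_⟩
  obtain ⟨M, hM0, hM⟩ := hM n
  refine ⟨|c| * (δ⁻¹) ^ n * M * ((d + b)⁻¹ * (δ / 2) ^ (-(d + b))), fun x => ?_⟩
  unfold dilationAverage
  rw [← hT.eq_iteratedFDeriv (by exact_mod_cast le_top)]
  set μ := max δ ‖x‖ with hμ
  have hμ0 : 0 < μ := lt_max_of_lt_left hδ
  have hIci : IntegrableOn (fun t : ℝ => |c| * (δ⁻¹) ^ n * M * t ^ (-(d + b) - 1)) (Set.Ici μ) := by
    rw [integrableOn_Ici_iff_integrableOn_Ioi]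
    exact (hI μ hμ0).const_mul _
  have hle : ‖∫ t in Set.Ioi δ, iteratedFDeriv ℝ n
      (fun x => c * t ^ (-b - 1) * ((t ^ d)⁻¹ * G (t⁻¹ • x))) x‖ ≤
      ∫ t in Set.Ioi δ, (Set.Ici μ).indicator
        (fun t : ℝ => |c| * (δ⁻¹) ^ n * M * t ^ (-(d + b) - 1)) t := by
    refine norm_integral_le_of_norm_le
      ((integrable_indicator_iff measurableSet_Ici).2 hIci).integrableOn ?_
    filter_upwards [ae_restrict_mem measurableSet_Ioi] with t (ht : δ < t)
    have h0 : 0 < t := hδ.trans ht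
    rw [hd, norm_smul]
    by_cases htμ : μ ≤ t
    · rw [Set.indicator_of_mem (Set.mem_Ici.2 htμ), mul_right_comm _ M]
      exact mul_le_mul (hpow n t ht) (hM _) (norm_nonneg _) ((norm_nonneg _).trans (hpow n t ht))
    · rw [Set.indicator_of_notMem (by simpa using htμ), hsupp, norm_zero, mul_zero]
      have : t < ‖x‖ := by
        rcases lt_max_iff.1 (not_le.1 htμ) with h | h
        · exact absurd h ht.not_gt
        · exact h
      rwa [norm_smul, norm_inv, Real.norm_of_nonneg h0.le, inv_mul_eq_div, one_lt_div h0]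
  refine hle.trans ?_
  rw [setIntegral_indicator measurableSet_Ici]
  calc ∫ t in Set.Ioi δ ∩ Set.Ici μ, |c| * (δ⁻¹) ^ n * M * t ^ (-(d + b) - 1)
      ≤ ∫ t in Set.Ici μ, |c| * (δ⁻¹) ^ n * M * t ^ (-(d + b) - 1) := by
        refine setIntegral_mono_set hIci ?_ (Filter.Eventually.of_forall Set.inter_subset_right)
        filter_upwards [ae_restrict_mem measurableSet_Ici] with t (ht : μ ≤ t)
        have h0 : 0 < t := hμ0.trans_le ht
        simp only [Pi.zero_apply]
        positivity
    _ = |c| * (δ⁻¹) ^ n * M * ((d + b)⁻¹ * μ ^ (-(d + b))) := by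
        rw [integral_Ici_eq_integral_Ioi, integral_const_mul,
          integral_Ioi_rpow_of_lt (by linarith) hμ0]
        congr 1
        rw [sub_add_cancel, neg_div_neg_eq, div_eq_inv_mul]
    _ ≤ |c| * (δ⁻¹) ^ n * M * ((d + b)⁻¹ * ((δ / 2) ^ (-(d + b)) * (1 + ‖x‖) ^ (-(d + b)))) := by
        gcongr
        rw [← Real.mul_rpow (by positivity) (by positivity)]
        refine Real.rpow_le_rpow_of_nonpos (by positivity) ?_ (by linarith)
        have h1 : δ ≤ μ := le_max_left _ _
        have h2 : ‖x‖ ≤ μ := le_max_right _ _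
        nlinarith [norm_nonneg x]
    _ = _ := by ring

end

/-! ### Fourier transform lemmas and the small scales -/

section
variable {d : ℕ}

theorem continuous_fourier_of_integrable {f : EuclideanSpace ℝ (Fin d) → ℂ} (hf : Integrable f) :
    Continuous (𝓕 f) :=
  VectorFourier.fourierIntegral_continuous Real.continuous_fourierChar
    (innerSL ℝ).continuous₂ hf

theorem norm_fourier_le (f : EuclideanSpace ℝ (Fin d) → ℂ) (ξ) : ‖𝓕 f ξ‖ ≤ ∫ x, ‖f x‖ :=
  VectorFourier.norm_fourierIntegral_le_integral_norm _ _ _ _ _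

theorem integral_fourier_mul {f g : EuclideanSpace ℝ (Fin d) → ℂ} (hf : Integrable f)
    (hg : Integrable g) : ∫ ξ, 𝓕 f ξ * g ξ = ∫ x, f x * 𝓕 g x := by
  have := VectorFourier.integral_fourierIntegral_smul_eq_flip (L := innerₗ _)
    Real.continuous_fourierChar (innerSL ℝ).continuous₂ hf hg
  rw [flip_innerₗ] at this
  exact this

theorem integral_fourierInv_mul {f g : EuclideanSpace ℝ (Fin d) → ℂ} (hf : Integrable f)
    (hg : Integrable g) : ∫ ξ, 𝓕⁻ f ξ * g ξ = ∫ x, f x * 𝓕⁻ g x := by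
  rw [Real.fourierInv_eq_fourier_comp_neg, integral_fourier_mul hf.comp_neg hg,
    ← integral_neg_eq_self]
  simp_rw [neg_neg, Real.fourierInv_eq_fourier_neg]

/-- A continuous function with `f(ξ) = O(‖ξ‖^(q - k))` for every `k` has an integrable product
with every polynomial. -/
theorem integrable_pow_mul_norm_of_rapid {f : EuclideanSpace ℝ (Fin d) → ℂ} (hf : Continuous f)
    {q : ℝ} (h : ∀ k : ℕ, q < k → ∃ C, 0 < C ∧ ∀ ξ, ξ ≠ 0 → ‖f ξ‖ ≤ C * ‖ξ‖ ^ (q - k)) (n : ℕ) :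
    Integrable (fun ξ => ‖ξ‖ ^ n * ‖f ξ‖) := by
  obtain ⟨k, hk⟩ := exists_nat_gt (max q (q + n + (d + 1)))
  obtain ⟨C, hC, hb⟩ := h k ((le_max_left _ _).trans_lt hk)
  have hk' : q + n + (d + 1) < k := (le_max_right _ _).trans_lt hk
  obtain ⟨M, hM⟩ := (isCompact_closedBall (0 : EuclideanSpace ℝ (Fin d)) 1).exists_bound_of_continuousOn
    hf.continuousOn
  have hJ : Integrable (fun ξ : EuclideanSpace ℝ (Fin d) => (1 + ‖ξ‖) ^ (-((d : ℝ) + 1))) :=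
    integrable_one_add_norm (by rw [finrank_euclideanSpace_fin]; linarith)
  refine (hJ.const_mul ((max M C) * 2 ^ ((d : ℝ) + 1))).mono' (by fun_prop)
    (Filter.Eventually.of_forall fun ξ => ?_)
  rw [Real.norm_of_nonneg (by positivity)]
  have hmax : 0 ≤ max M C := hC.le.trans (le_max_right _ _)
  rcases le_or_gt ‖ξ‖ 1 with hξ | hξ
  · calc ‖ξ‖ ^ n * ‖f ξ‖ ≤ 1 * max M C := by
          gcongr
          · exact pow_le_one₀ (norm_nonneg _) hξ
          · exact (hM ξ (by simpa using hξ)).trans (le_max_left _ _)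
      _ = max M C * 1 := by ring
      _ ≤ max M C * (2 ^ ((d : ℝ) + 1) * (1 + ‖ξ‖) ^ (-((d : ℝ) + 1))) := by
          gcongr
          rw [Real.rpow_neg (by positivity), ← div_eq_mul_inv, one_le_div (by positivity)]
          gcongr
          linarith
      _ = _ := by ring
  · have h0 : 0 < ‖ξ‖ := one_pos.trans hξ
    calc ‖ξ‖ ^ n * ‖f ξ‖ ≤ ‖ξ‖ ^ n * (max M C * ‖ξ‖ ^ (q - k)) := by
          gcongr
          refine (hb ξ (norm_pos_iff.1 h0)).trans ?_
          gcongr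
          exact le_max_right _ _
      _ = max M C * ‖ξ‖ ^ (n + (q - k)) := by
          rw [Real.rpow_add h0, Real.rpow_natCast]; ring
      _ ≤ max M C * ‖ξ‖ ^ (-((d : ℝ) + 1)) := by
          gcongr
          · exact hξ.le
          · linarith
      _ ≤ max M C * (2⁻¹ * (1 + ‖ξ‖)) ^ (-((d : ℝ) + 1)) := by
          gcongr ?_ * ?_
          exact Real.rpow_le_rpow_of_nonpos (by positivity) (by linarith) (by linarith)
      _ = _ := by
          rw [Real.mul_rpow (by positivity) (by positivity), Real.inv_rpow (by positivity),
            Real.rpow_neg (by positivity), inv_inv]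
          ring

theorem contDiff_fourierInv_of_rapid {f : EuclideanSpace ℝ (Fin d) → ℂ}
    (hf : ∀ n : ℕ, Integrable (fun ξ => ‖ξ‖ ^ n * ‖f ξ‖)) : ContDiff ℝ ∞ (𝓕⁻ f) := by
  have h1 : 𝓕⁻ f = fun x => 𝓕 f (-x) := by
    ext x
    exact Real.fourierInv_eq_fourier_neg f x
  rw [h1]
  exact (Real.contDiff_fourier (N := ⊤) fun n _ => hf n).comp contDiff_neg

variable {p : ℕ} {G : EuclideanSpace ℝ (Fin d) → ℝ} {γ : ℝ → ℝ}

theorem IsRadialProfile.integrable (h : IsRadialProfile p G γ) : Integrable G :=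
  h.contDiff.continuous.integrable_of_hasCompactSupport (hasCompactSupport_of_norm h.eq_zero)

theorem IsRadialProfile.fourier_dilationAverage (h : IsRadialProfile p G γ) {S : Set ℝ}
    (hS : MeasurableSet S) (hS0 : S ⊆ Set.Ioi 0) {c q : ℝ}
    (hw : IntegrableOn (fun t => c * t ^ q) S) (ξ : EuclideanSpace ℝ (Fin d)) :
    𝓕 (fun x => (dilationAverage (fun t => c * t ^ q) S G x : ℂ)) ξ =
      ((c * ∫ t in S, t ^ q * γ (t * ‖ξ‖) : ℝ) : ℂ) := by
  rw [FractionalLaplacian.fourier_dilationAverage h.contDiff.continuous h.integrable hS hS0 hw,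
    ← integral_const_mul, ← integral_complex_ofReal]
  refine setIntegral_congr_fun hS fun t ht => ?_
  have h0 : 0 < t := hS0 ht
  simp only [h.fourier, norm_smul, Real.norm_of_nonneg h0.le]
  push_cast
  ring

theorem IsRadialProfile.integral_add_tail (h : IsRadialProfile p G γ) {q : ℝ} (hq : -1 < q + p)
    {δ : ℝ} (hδ : 0 < δ) {ρ : ℝ} (hρ : 0 < ρ) :
    (∫ t in Set.Ioc 0 δ, t ^ q * γ (t * ρ)) + ∫ t in Set.Ioi δ, t ^ q * γ (t * ρ) =
      ρ ^ (-q - 1) * ∫ t in Set.Ioi 0, t ^ q * γ t := by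
  rw [← integral_Ioi_rpow_mul_comp_mul γ q hρ, ← Set.Ioc_union_Ioi_eq_Ioi hδ.le,
    setIntegral_union (Set.Ioc_disjoint_Ioi le_rfl) measurableSet_Ioi]
  · exact (h.integrableOn_mul hq hρ).mono_set Set.Ioc_subset_Ioi_self
  · exact (h.integrableOn_mul hq hρ).mono_set (Set.Ioi_subset_Ioi hδ.le)

/-- The small-scale part `c ∫_0^δ r^(-b-1) 𝓕G(r ξ) dr` of a Fourier multiplier acts as a
distribution supported in the ball of radius `δ`: composed with convolution by a function `E`
supported in that ball, it annihilates test functions that vanish on the ball of radius `2 δ`. -/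
theorem IsRadialProfile.integral_small_scale_eq_zero (h : IsRadialProfile p G γ) {q : ℝ}
    (hq : -1 < q + p) {δ : ℝ} {E : EuclideanSpace ℝ (Fin d) → ℝ}
    (hE : Integrable E) (hE0 : ∀ x, δ < ‖x‖ → E x = 0)
    (χ : SchwartzMap (EuclideanSpace ℝ (Fin d)) ℂ)
    (hχ : ∀ x, ‖x‖ ≤ 2 * δ → 𝓕 (χ : EuclideanSpace ℝ (Fin d) → ℂ) x = 0) :
    ∫ ξ, ((∫ r in Set.Ioc 0 δ, r ^ q * γ (r * ‖ξ‖) : ℝ) : ℂ) *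
      𝓕 (fun x => (E x : ℂ)) ξ * χ ξ = 0 := by
  have hEc := continuous_fourier_of_integrable (f := fun x => (E x : ℂ)) hE.ofReal
  set Eh := 𝓕 (fun x => (E x : ℂ)) with hEh
  -- The inner integral pairs `G_r ⋆ E`, which lives in the ball of radius `r + δ ≤ 2 δ`, with the
  -- test function `𝓕 χ`, which vanishes there.
  have hinner : ∀ r ∈ Set.Ioc 0 δ, ∫ ξ, (γ (r * ‖ξ‖) : ℂ) * Eh ξ * χ ξ = 0 := by
    intro r hr
    have h1 : ∀ ξ, (γ (r * ‖ξ‖) : ℂ) * Eh ξ =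
        𝓕 (fun x => ((∫ y, E y * ((r ^ d)⁻¹ * G (r⁻¹ • (x - y))) : ℝ) : ℂ)) ξ := by
      intro ξ
      rw [fourier_ofReal_convolution (g := fun x => (r ^ d)⁻¹ * G (r⁻¹ • x)) hE
        (integrable_dilate h.integrable hr.1), fourier_dilate G hr.1, h.fourier, norm_smul,
        Real.norm_of_nonneg hr.1.le, mul_comm]
    have hHi : Integrable
        (fun x => ((∫ y, E y * ((r ^ d)⁻¹ * G (r⁻¹ • (x - y))) : ℝ) : ℂ)) := by
      rw [ofReal_integral_mul_sub E (fun x => (r ^ d)⁻¹ * G (r⁻¹ • x))]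
      exact Integrable.integrable_convolution _ hE.ofReal
        (integrable_dilate h.integrable hr.1).ofReal
    simp_rw [h1]
    rw [integral_fourier_mul hHi χ.integrable]
    refine integral_eq_zero_of_ae (Filter.Eventually.of_forall fun x => ?_)
    rcases le_or_gt ‖x‖ (2 * δ) with hx | hx
    · simp [hχ x hx]
    · have : ∫ y, E y * ((r ^ d)⁻¹ * G (r⁻¹ • (x - y))) = 0 := by
        refine integral_eq_zero_of_ae (Filter.Eventually.of_forall fun y => ?_)
        rcases le_or_gt ‖y‖ δ with hy | hy
        · have h2 : r < ‖x - y‖ := by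
            have := norm_sub_norm_le x y
            have := hr.2
            linarith
          have h3 : G (r⁻¹ • (x - y)) = 0 := by
            apply h.eq_zero
            rwa [norm_smul, norm_inv, Real.norm_of_nonneg hr.1.le, inv_mul_eq_div, one_lt_div hr.1]
          simp [h3]
        · simp [hE0 y hy]
      simp only [this]
      simp
  obtain ⟨C, hC⟩ := h.small
  have hγm := h.continuous.measurable
  have hint : Integrable (fun z : EuclideanSpace ℝ (Fin d) × ℝ =>
      ((z.2 ^ q * γ (z.2 * ‖z.1‖) : ℝ) : ℂ) * Eh z.1 * χ z.1)
      (volume.prod (volume.restrict (Set.Ioc 0 δ))) := by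
    have hI1 : Integrable (fun ξ : EuclideanSpace ℝ (Fin d) => ‖ξ‖ ^ p * ‖χ ξ‖) :=
      χ.integrable_pow_mul volume p
    have hI2 : IntegrableOn (fun r : ℝ => r ^ (q + p)) (Set.Ioc 0 δ) := by
      rcases le_or_gt δ 0 with hδ | hδ
      · simp [Set.Ioc_eq_empty_of_le hδ]
      have := intervalIntegral.intervalIntegrable_rpow' (a := 0) (b := δ) hq
      rwa [intervalIntegrable_iff_integrableOn_Ioc_of_le hδ.le] at this
    have hI3 := (hI1.mul_prod hI2).const_mul (|C| * ∫ x, ‖(E x : ℂ)‖)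
    refine hI3.mono' (Measurable.aestronglyMeasurable ?_) ?_
    · have := hEc.measurable
      have := χ.continuous.measurable
      fun_prop
    · have : ∀ᵐ z ∂((volume : Measure (EuclideanSpace ℝ (Fin d))).prod
          (volume.restrict (Set.Ioc 0 δ))), z.2 ∈ Set.Ioc 0 δ :=
        Measure.quasiMeasurePreserving_snd.ae (ae_restrict_mem measurableSet_Ioc)
      filter_upwards [this] with z hz
      have h0 : 0 < z.2 := hz.1
      have hp : 0 ≤ z.2 * ‖z.1‖ := by positivity
      rw [norm_mul, norm_mul, Complex.norm_real,
        Real.norm_of_nonneg (mul_nonneg (by positivity) (h.nonneg _ hp))]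
      calc z.2 ^ q * γ (z.2 * ‖z.1‖) * ‖Eh z.1‖ * ‖χ z.1‖
          ≤ z.2 ^ q * (|C| * (z.2 * ‖z.1‖) ^ p) * (∫ x, ‖(E x : ℂ)‖) * ‖χ z.1‖ := by
            gcongr
            · exact (hC _ hp).trans (by gcongr; exact le_abs_self C)
            · exact norm_fourier_le _ _
        _ = _ := by
            rw [Real.rpow_add h0, Real.rpow_natCast]
            ring
  have hswap : ∀ ξ, ((∫ r in Set.Ioc 0 δ, r ^ q * γ (r * ‖ξ‖) : ℝ) : ℂ) * Eh ξ * χ ξ =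
      ∫ r in Set.Ioc 0 δ, ((r ^ q * γ (r * ‖ξ‖) : ℝ) : ℂ) * Eh ξ * χ ξ := by
    intro ξ
    rw [integral_mul_const, integral_mul_const, integral_complex_ofReal]
  simp_rw [hswap]
  rw [integral_integral_swap hint]
  refine setIntegral_eq_zero_of_forall_eq_zero fun r hr => ?_
  have : ∀ ξ, ((r ^ q * γ (r * ‖ξ‖) : ℝ) : ℂ) * Eh ξ * χ ξ =
      ((r ^ q : ℝ) : ℂ) * ((γ (r * ‖ξ‖) : ℂ) * Eh ξ * χ ξ) := fun ξ => by push_cast; ring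
  simp_rw [this]
  rw [integral_const_mul, hinner r hr, mul_zero]

end

/-! ### The parametrix -/

/-- A parametrix for `(-Δ)^s`: an integrable function `E` supported in the ball of radius `1/4`
with `(-Δ)^s E = δ - K`, where the kernel `K = 𝓕⁻ Kh` is smooth and decays, with all its
derivatives, like `‖x‖^(-d-2s)`. -/
theorem exists_parametrix {d : ℕ} (hd : 0 < d) {s : ℝ} (hs : 0 < s) :
    ∃ (E : EuclideanSpace ℝ (Fin d) → ℝ) (Kh : EuclideanSpace ℝ (Fin d) → ℂ),
      Integrable E ∧ (∀ x, 1 / 4 < ‖x‖ → E x = 0) ∧ Integrable Kh ∧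
      SmoothDecay (d + 2 * s) (𝓕⁻ Kh) ∧
      ∀ ξ, (((2 * Real.pi * ‖ξ‖) ^ (2 * s) : ℝ) : ℂ) * 𝓕 (fun x => (E x : ℂ)) ξ = 1 - Kh ξ := by
  obtain ⟨m, hm⟩ := exists_nat_gt s
  obtain ⟨G, γ, h⟩ := exists_isRadialProfile hd m
  have hqE : -1 < (2 * s - 1) + ((2 * m : ℕ) : ℝ) := by push_cast; linarith
  have hqN : -1 < (-(2 * s) - 1) + ((2 * m : ℕ) : ℝ) := by push_cast; linarith
  have hA := h.integral_pos hqN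
  have hB := h.integral_pos hqE
  set A := ∫ t in Set.Ioi 0, t ^ (-(2 * s) - 1) * γ t with hAdef
  set B := ∫ t in Set.Ioi 0, t ^ (2 * s - 1) * γ t with hBdef
  have hδ : (0 : ℝ) < 1 / 4 := by norm_num
  set δ : ℝ := 1 / 4 with hδdef
  have h2π : (0 : ℝ) < (2 * Real.pi) ^ (2 * s) := by positivity
  set c₁ := (2 * Real.pi) ^ (2 * s) / A with hc₁
  set c₂ := ((2 * Real.pi) ^ (2 * s) * B)⁻¹ with hc₂
  set E := dilationAverage (fun t => c₂ * t ^ (2 * s - 1)) (Set.Ioc 0 δ) G with hEdef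
  set N := dilationAverage (fun t => c₁ * t ^ (-(2 * s) - 1)) (Set.Ioi δ) G with hNdef
  -- `E` collects the small scales of `|2πξ|^(-2s)`, `N` the large scales of `|2πξ|^(2s)`.
  have hwE : IntegrableOn (fun t : ℝ => c₂ * t ^ (2 * s - 1)) (Set.Ioc 0 δ) := by
    have := intervalIntegral.intervalIntegrable_rpow' (a := 0) (b := δ)
      (by linarith : -1 < 2 * s - 1)
    rw [intervalIntegrable_iff_integrableOn_Ioc_of_le hδ.le] at this
    exact this.const_mul _
  have hwN : IntegrableOn (fun t : ℝ => c₁ * t ^ (-(2 * s) - 1)) (Set.Ioi δ) :=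
    (integrableOn_Ioi_rpow_of_lt (by linarith) hδ).const_mul _
  have hGc := h.contDiff.continuous
  have hEi : Integrable E := integrable_dilationAverage hGc h.integrable measurableSet_Ioc
    Set.Ioc_subset_Ioi_self hwE
  have hNi : Integrable N := integrable_dilationAverage hGc h.integrable measurableSet_Ioi
    (Set.Ioi_subset_Ioi hδ.le) hwN
  have hE0 : ∀ x, δ < ‖x‖ → E x = 0 := fun x hx =>
    dilationAverage_eq_zero subset_rfl h.eq_zero hx
  have hNd : SmoothDecay (d + 2 * s) N :=
    smoothDecay_dilationAverage h.contDiff h.eq_zero (by linarith) hδ (by norm_num [hδdef])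
  have hEf := h.fourier_dilationAverage measurableSet_Ioc Set.Ioc_subset_Ioi_self hwE
  have hNf := h.fourier_dilationAverage measurableSet_Ioi (Set.Ioi_subset_Ioi hδ.le) hwN
  rw [← hEdef] at hEf
  rw [← hNdef] at hNf
  have hEc := continuous_fourier_of_integrable (f := fun x => (E x : ℂ)) hEi.ofReal
  have hNc := continuous_fourier_of_integrable (f := fun x => (N x : ℂ)) hNi.ofReal
  -- The exponents are those for which the dilation averages over all scales are homogeneous of
  -- degrees `2s` and `-2s`; at `ξ = 0` both identities fail, which is a null set.
  have hsymb : ∀ ξ : EuclideanSpace ℝ (Fin d), ξ ≠ 0 → (2 * Real.pi * ‖ξ‖) ^ (2 * s) =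
      (c₁ * ∫ t in Set.Ioc 0 δ, t ^ (-(2 * s) - 1) * γ (t * ‖ξ‖)) +
        c₁ * ∫ t in Set.Ioi δ, t ^ (-(2 * s) - 1) * γ (t * ‖ξ‖) := by
    intro ξ hξ
    rw [← mul_add, h.integral_add_tail hqN hδ (norm_pos_iff.2 hξ), ← hAdef,
      Real.mul_rpow (by positivity) (norm_nonneg _), hc₁]
    rw [show -(-(2 * s) - 1) - 1 = 2 * s by ring]
    field_simp
  have hinv : ∀ ξ : EuclideanSpace ℝ (Fin d), ξ ≠ 0 →
      1 - (2 * Real.pi * ‖ξ‖) ^ (2 * s) *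
        (c₂ * ∫ t in Set.Ioc 0 δ, t ^ (2 * s - 1) * γ (t * ‖ξ‖)) =
      (2 * Real.pi * ‖ξ‖) ^ (2 * s) *
        (c₂ * ∫ t in Set.Ioi δ, t ^ (2 * s - 1) * γ (t * ‖ξ‖)) := by
    intro ξ hξ
    have hξ0 := norm_pos_iff.2 hξ
    rw [sub_eq_iff_eq_add', ← mul_add, ← mul_add, h.integral_add_tail hqE hδ hξ0, ← hBdef,
      Real.mul_rpow (by positivity) (norm_nonneg _), hc₂]
    rw [show -(2 * s - 1) - 1 = -(2 * s) by ring, Real.rpow_neg hξ0.le]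
    field_simp
  let Kh : EuclideanSpace ℝ (Fin d) → ℂ := fun ξ =>
    1 - (((2 * Real.pi * ‖ξ‖) ^ (2 * s) : ℝ) : ℂ) * 𝓕 (fun x => (E x : ℂ)) ξ
  have hsc : Continuous fun ξ : EuclideanSpace ℝ (Fin d) => (2 * Real.pi * ‖ξ‖) ^ (2 * s) :=
    Continuous.rpow_const (by fun_prop) fun _ => Or.inr (by linarith)
  have hKhc : Continuous Kh :=
    continuous_const.sub ((Complex.continuous_ofReal.comp hsc).mul hEc)
  have hKhr : ∀ n : ℕ, Integrable (fun ξ => ‖ξ‖ ^ n * ‖Kh ξ‖) := by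
    -- `Kh` is `|2πξ|^(2s)` times the large scales of `|2πξ|^(-2s)`, where `γ` decays rapidly.
    refine integrable_pow_mul_norm_of_rapid hKhc (q := 2 * s) fun k hk => ?_
    obtain ⟨C, hC0, hC⟩ := h.tail_le (q := 2 * s - 1) hδ k (by linarith)
    refine ⟨(2 * Real.pi) ^ (2 * s) * |c₂| * C + 1, by positivity, fun ξ hξ => ?_⟩
    have hξ0 := norm_pos_iff.2 hξ
    have h1 : Kh ξ = (((2 * Real.pi * ‖ξ‖) ^ (2 * s) *
        (c₂ * ∫ t in Set.Ioi δ, t ^ (2 * s - 1) * γ (t * ‖ξ‖)) : ℝ) : ℂ) := by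
      rw [← hinv ξ hξ]
      simp only [Kh]
      rw [hEf]
      push_cast
      rfl
    rw [h1, Complex.norm_real, norm_mul, norm_mul, Real.norm_of_nonneg (by positivity),
      Real.norm_eq_abs, Real.norm_eq_abs, Real.mul_rpow (by positivity) hξ0.le,
      sub_eq_add_neg (2 * s) (k : ℝ), Real.rpow_add hξ0]
    calc (2 * Real.pi) ^ (2 * s) * ‖ξ‖ ^ (2 * s) *
          (|c₂| * |∫ t in Set.Ioi δ, t ^ (2 * s - 1) * γ (t * ‖ξ‖)|)
        ≤ (2 * Real.pi) ^ (2 * s) * ‖ξ‖ ^ (2 * s) * (|c₂| * (C * ‖ξ‖ ^ (-(k : ℝ)))) := by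
          gcongr; exact hC _ hξ0
      _ = (2 * Real.pi) ^ (2 * s) * |c₂| * C * (‖ξ‖ ^ (2 * s) * ‖ξ‖ ^ (-(k : ℝ))) := by ring
      _ ≤ _ := by gcongr; linarith
  have hKhi : Integrable Kh := by
    have := hKhr 0
    simp only [pow_zero, one_mul] at this
    exact (integrable_norm_iff hKhc.aestronglyMeasurable).1 this
  have hKs : ContDiff ℝ ∞ (𝓕⁻ Kh) := contDiff_fourierInv_of_rapid hKhr
  have hNEd := hNd.integral_smul_sub (μ := volume) (by positivity) hEi
    (fun y hy => hE0 y (by rw [hδdef]; linarith))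
  set NE : EuclideanSpace ℝ (Fin d) → ℝ := fun x => ∫ y, E y * N (x - y) with hNE
  have hNEd' : SmoothDecay (d + 2 * s) NE := hNEd
  have hNEi : Integrable (fun x => (NE x : ℂ)) := by
    rw [hNE, ofReal_integral_mul_sub E N]
    exact Integrable.integrable_convolution _ hEi.ofReal hNi.ofReal
  -- `𝓕⁻ Kh + N ⋆ E = δ₀ - (small scales of (-Δ)^s) ⋆ E`, with `δ₀` the Dirac mass, is supported in
  -- the ball of radius `2 δ`.
  have hcancel : ∀ x, 2 * δ < ‖x‖ → 𝓕⁻ Kh x + (NE x : ℂ) = 0 := by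
    have hWc : Continuous fun x => 𝓕⁻ Kh x + (NE x : ℂ) :=
      hKs.continuous.add (Complex.continuous_ofReal.comp hNEd'.1.continuous)
    have hU : IsOpen {x : EuclideanSpace ℝ (Fin d) | 2 * δ < ‖x‖} :=
      isOpen_lt continuous_const continuous_norm
    have hae := hU.ae_eq_zero_of_integral_contDiff_smul_eq_zero
      (f := fun x => 𝓕⁻ Kh x + (NE x : ℂ)) (μ := volume)
      (hWc.locallyIntegrable.locallyIntegrableOn _) (by
        intro g hg hgc hgU
        let ψ : SchwartzMap (EuclideanSpace ℝ (Fin d)) ℂ :=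
          HasCompactSupport.toSchwartzMap (f := fun x => (g x : ℂ))
            (hgc.comp_left (g := fun r : ℝ => (r : ℂ)) Complex.ofReal_zero)
            (Complex.ofRealCLM.contDiff.comp hg)
        have hψ : ∀ x, ψ x = (g x : ℂ) := fun x => rfl
        set χ := 𝓕⁻ ψ with hχ
        have hχψ : 𝓕 (χ : EuclideanSpace ℝ (Fin d) → ℂ) = ψ := by
          rw [← SchwartzMap.fourier_coe, hχ, FourierTransform.fourier_fourierInv_eq]
        have hχi : (χ : EuclideanSpace ℝ (Fin d) → ℂ) = 𝓕⁻ (ψ : EuclideanSpace ℝ (Fin d) → ℂ) :=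
          SchwartzMap.fourierInv_coe ψ
        have hg0 : ∀ x, ‖x‖ ≤ 2 * δ → g x = 0 := fun x hx =>
          image_eq_zero_of_notMem_tsupport fun hx' => not_lt.2 hx (hgU hx')
        have hsmall := h.integral_small_scale_eq_zero hqN hEi hE0 χ
          (fun x hx => by rw [hχψ, hψ, hg0 x hx, Complex.ofReal_zero])
        have hχint : ∫ ξ, χ ξ = 0 := by
          have h0 : 𝓕 (χ : EuclideanSpace ℝ (Fin d) → ℂ) 0 = 0 := by
            rw [hχψ, hψ, hg0 0 (by simpa using hδ.le), Complex.ofReal_zero]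
          rw [Real.fourier_eq] at h0
          simpa using h0
        have hi1 : Integrable (fun x => 𝓕⁻ Kh x * ψ x) := by
          refine ψ.integrable.bdd_mul (c := ∫ x, ‖Kh x‖) hKs.continuous.aestronglyMeasurable
            (Filter.Eventually.of_forall fun x => ?_)
          rw [Real.fourierInv_eq_fourier_neg]
          exact norm_fourier_le _ _
        obtain ⟨C, hC0, hC⟩ := hNEd'.norm_le
        have hi2 : Integrable (fun x => (NE x : ℂ) * ψ x) := by
          refine ψ.integrable.bdd_mul (c := C) hNEi.aestronglyMeasurable
            (Filter.Eventually.of_forall fun x => ?_)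
          rw [Complex.norm_real]
          refine (hC x).trans (mul_le_of_le_one_right hC0.le ?_)
          exact Real.rpow_le_one_of_one_le_of_nonpos (by linarith [norm_nonneg x])
            (by have : (0:ℝ) ≤ d := d.cast_nonneg
                linarith)
        have hi3 : Integrable (fun ξ => Kh ξ * χ ξ) := by
          obtain ⟨C, hC⟩ : ∃ C, ∀ ξ, ‖χ ξ‖ ≤ C :=
            ⟨_, fun ξ => χ.norm_le_seminorm ℝ ξ⟩
          exact hKhi.mul_bdd (c := C) χ.continuous.aestronglyMeasurable
            (Filter.Eventually.of_forall hC)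
        have hi4 : Integrable (fun ξ => 𝓕 (fun x => (E x : ℂ)) ξ * 𝓕 (fun x => (N x : ℂ)) ξ
            * χ ξ) := by
          refine χ.integrable.bdd_mul (c := (∫ x, ‖(E x : ℂ)‖) * ∫ x, ‖(N x : ℂ)‖)
            (hEc.mul hNc).aestronglyMeasurable (Filter.Eventually.of_forall fun ξ => ?_)
          rw [norm_mul]
          gcongr <;> exact norm_fourier_le _ _
        have hpt : ∀ᵐ ξ : EuclideanSpace ℝ (Fin d),
            c₁ * (((∫ r in Set.Ioc 0 δ, r ^ (-(2 * s) - 1) * γ (r * ‖ξ‖) : ℝ) : ℂ) *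
                𝓕 (fun x => (E x : ℂ)) ξ * χ ξ) = χ ξ - (Kh ξ * χ ξ +
              𝓕 (fun x => (E x : ℂ)) ξ * 𝓕 (fun x => (N x : ℂ)) ξ * χ ξ) := by
          have : Nonempty (Fin d) := ⟨⟨0, hd⟩⟩
          filter_upwards [Measure.ae_ne volume 0] with ξ hξ
          simp only [Kh]
          rw [hsymb ξ hξ, hNf]
          push_cast
          ring
        have hi5 := (χ.integrable.sub (hi3.add hi4)).congr (hpt.mono fun ξ hξ => hξ.symm)
        calc ∫ x, g x • (𝓕⁻ Kh x + (NE x : ℂ))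
            = ∫ x, (𝓕⁻ Kh x * ψ x + (NE x : ℂ) * ψ x) := by
              congr 1; ext x; rw [hψ, Complex.real_smul]; ring
          _ = (∫ x, 𝓕⁻ Kh x * ψ x) + ∫ x, (NE x : ℂ) * ψ x := integral_add hi1 hi2
          _ = (∫ ξ, Kh ξ * χ ξ) + ∫ ξ, 𝓕 (fun x => (E x : ℂ)) ξ * 𝓕 (fun x => (N x : ℂ)) ξ
                * χ ξ := by
              rw [integral_fourierInv_mul hKhi ψ.integrable, ← hχi]
              congr 1
              rw [← hχψ, ← integral_fourier_mul hNEi χ.integrable]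
              simp_rw [hNE, fourier_ofReal_convolution hEi hNi]
          _ = ∫ ξ, (Kh ξ * χ ξ + 𝓕 (fun x => (E x : ℂ)) ξ * 𝓕 (fun x => (N x : ℂ)) ξ
                * χ ξ) := (integral_add hi3 hi4).symm
          _ = ∫ ξ, (χ ξ - c₁ * (((∫ r in Set.Ioc 0 δ, r ^ (-(2 * s) - 1) * γ (r * ‖ξ‖) : ℝ) : ℂ) *
                𝓕 (fun x => (E x : ℂ)) ξ * χ ξ)) := by
              refine integral_congr_ae ?_
              filter_upwards [hpt] with ξ hξ
              rw [hξ, sub_sub_cancel]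
          _ = 0 := by
              rw [integral_sub χ.integrable hi5, hχint, integral_const_mul, hsmall, mul_zero,
                sub_zero])
    have heq := Measure.eqOn_open_of_ae_eq (μ := volume) (f := fun x => 𝓕⁻ Kh x + (NE x : ℂ))
      (g := fun _ => 0) ((ae_restrict_iff' hU.measurableSet).2 hae) hU hWc.continuousOn
      continuousOn_const
    exact fun x hx => heq hx
  refine ⟨E, Kh, hEi, hE0, hKhi, ?_, fun ξ => by simp [Kh]⟩
  refine (hNEd'.clm_comp (-Complex.ofRealCLM)).of_eqOn_compl (by positivity) hKs (ρ := 2 * δ)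
    fun x hx => ?_
  simpa using eq_neg_of_add_eq_zero_left (hcancel x hx)

/-! ### The local representation formula -/

section
variable {d : ℕ} {s : ℝ} {E : EuclideanSpace ℝ (Fin d) → ℝ} {Kh : EuclideanSpace ℝ (Fin d) → ℂ}

/-- Multiplication by `f` on the Fourier side is convolution with `𝓕⁻ f`; neither `𝓕⁻ f` nor `𝓕 g`
needs to be integrable. -/
theorem fourierInv_mul_fourier {f g : EuclideanSpace ℝ (Fin d) → ℂ} (hf : Integrable f)
    (hg : Integrable g) (y : EuclideanSpace ℝ (Fin d)) :
    𝓕⁻ (fun ξ => f ξ * 𝓕 g ξ) y = ∫ x, 𝓕⁻ f (y - x) * g x := by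
  have h1 : 𝓕⁻ (fun ξ => f ξ * 𝓕 g ξ) y =
      ∫ ξ, (Real.fourierChar (inner ℝ ξ y) • f ξ) * 𝓕 g ξ := by
    rw [Real.fourierInv_eq]
    simp [Circle.smul_def, mul_assoc]
  have hi : Integrable (fun ξ => Real.fourierChar (inner ℝ ξ y) • f ξ) := by
    have := (Real.fourierIntegral_convergent_iff (f := f) (μ := volume) (-y)).2 hf
    simpa using this
  rw [h1, ← integral_fourier_mul hi hg]
  congr 1
  ext x
  congr 1
  rw [Real.fourier_eq, Real.fourierInv_eq]
  congr 1
  ext ξ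
  rw [smul_smul, ← AddChar.map_add_eq_mul, inner_sub_right]
  congr 2
  ring

/-- If `E` is a parametrix, that is `(-Δ)^s E = δ - K`, then `(-Δ)^s (E ⋆ ψ) = ψ - K ⋆ ψ`. -/
theorem fracLaplacian_convolution (hE : Integrable E) (hKh : Integrable Kh)
    (hEK : ∀ ξ, (((2 * Real.pi * ‖ξ‖) ^ (2 * s) : ℝ) : ℂ) * 𝓕 (fun x => (E x : ℂ)) ξ = 1 - Kh ξ)
    {ψ : EuclideanSpace ℝ (Fin d) → ℝ} (hψ : ContDiff ℝ ∞ ψ) (hψc : HasCompactSupport ψ)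
    (y : EuclideanSpace ℝ (Fin d)) :
    fracLaplacian s (fun x => ∫ z, E z * ψ (x - z)) y =
      ψ y - ∫ x, 𝓕⁻ Kh (y - x) * ψ x := by
  let Ψ : SchwartzMap (EuclideanSpace ℝ (Fin d)) ℂ :=
    HasCompactSupport.toSchwartzMap (f := fun x => (ψ x : ℂ))
      (hψc.comp_left (g := fun r : ℝ => (r : ℂ)) Complex.ofReal_zero)
      (Complex.ofRealCLM.contDiff.comp hψ)
  have hΨ : (Ψ : EuclideanSpace ℝ (Fin d) → ℂ) = fun x => (ψ x : ℂ) := rfl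
  have hψi : Integrable ψ := hψ.continuous.integrable_of_hasCompactSupport hψc
  have hF : 𝓕 (fun x => (ψ x : ℂ)) = (𝓕 Ψ : SchwartzMap (EuclideanSpace ℝ (Fin d)) ℂ) := by
    rw [SchwartzMap.fourier_coe, hΨ]
  have hi1 : Integrable (𝓕 (fun x => (ψ x : ℂ))) := by
    rw [hF]; exact (𝓕 Ψ).integrable
  have hi2 : Integrable (fun ξ => Kh ξ * 𝓕 (fun x => (ψ x : ℂ)) ξ) :=
    hKh.mul_bdd (c := ∫ x, ‖(ψ x : ℂ)‖)
      (continuous_fourier_of_integrable hψi.ofReal).aestronglyMeasurable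
      (Filter.Eventually.of_forall fun ξ => norm_fourier_le _ _)
  have h1 : (fun ξ : EuclideanSpace ℝ (Fin d) => (((2 * Real.pi * ‖ξ‖) ^ (2 * s) : ℝ) : ℂ) *
      𝓕 (fun x => ((∫ z, E z * ψ (x - z) : ℝ) : ℂ)) ξ) =
      fun ξ => 𝓕 (fun x => (ψ x : ℂ)) ξ - Kh ξ * 𝓕 (fun x => (ψ x : ℂ)) ξ := by
    ext ξ
    rw [fourier_ofReal_convolution hE hψi, ← mul_assoc, hEK]
    ring
  have h2 : 𝓕⁻ (𝓕 (fun x => (ψ x : ℂ))) y = ψ y :=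
    congrFun (Continuous.fourierInv_fourier_eq (Complex.continuous_ofReal.comp hψ.continuous)
      hψi.ofReal hi1) y
  unfold fracLaplacian
  have hψC : Integrable (fun x => (ψ x : ℂ)) := hψi.ofReal
  rw [h1, ← h2, ← fourierInv_mul_fourier hKh hψC, Real.fourierInv_eq, Real.fourierInv_eq,
    Real.fourierInv_eq, ← integral_sub]
  · simp_rw [smul_sub]
  · simpa using (Real.fourierIntegral_convergent_iff (μ := volume) (-y)).2 hi1
  · simpa using (Real.fourierIntegral_convergent_iff (μ := volume) (-y)).2 hi2

theorem locallyIntegrable_of_integrable_weight {a : ℝ} {u : EuclideanSpace ℝ (Fin d) → ℝ}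
    (hum : AEStronglyMeasurable u) (hu : Integrable (fun y => |u y| * (1 + ‖y‖) ^ (-a))) :
    LocallyIntegrable u := by
  have hc : ∀ b : ℝ, Continuous fun y : EuclideanSpace ℝ (Fin d) => (1 + ‖y‖) ^ b := fun b =>
    Continuous.rpow_const (by fun_prop) fun y => Or.inl (by positivity)
  have h1 : Integrable (fun y => (1 + ‖y‖) ^ (-a) * u y) := by
    refine hu.mono' ((hc _).aestronglyMeasurable.mul hum) (Filter.Eventually.of_forall fun y => ?_)
    rw [norm_mul, Real.norm_of_nonneg (by positivity), Real.norm_eq_abs, mul_comm]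
  rw [← locallyIntegrableOn_univ]
  refine ((h1.locallyIntegrable.locallyIntegrableOn Set.univ).continuousOn_mul (hc a).continuousOn
    isOpen_univ.isLocallyClosed).congr (Filter.Eventually.of_forall fun y => ?_)
  rw [← mul_assoc, ← Real.rpow_add (by positivity), add_neg_cancel, Real.rpow_zero, one_mul]

/-- A function that is `s`-harmonic in the ball of radius `2` coincides in the ball of radius `3/2`
with its convolution with the smooth kernel of a parametrix supported in the ball of
radius `1/4`. -/
theorem ae_eq_convolution_of_isDistribHarmonic (hs : 0 < s) (hE : Integrable E)
    (hE0 : ∀ x, 1 / 4 < ‖x‖ → E x = 0) (hKh : Integrable Kh)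
    (hK : SmoothDecay (d + 2 * s) (𝓕⁻ Kh))
    (hEK : ∀ ξ, (((2 * Real.pi * ‖ξ‖) ^ (2 * s) : ℝ) : ℂ) * 𝓕 (fun x => (E x : ℂ)) ξ = 1 - Kh ξ)
    {u : EuclideanSpace ℝ (Fin d) → ℝ} (hum : AEStronglyMeasurable u)
    (hu : Integrable (fun y => |u y| * (1 + ‖y‖) ^ (-(d + 2 * s))))
    (hharm : IsDistribHarmonic s (openBall d 2) u) :
    ∀ᵐ x, x ∈ Metric.ball (0 : EuclideanSpace ℝ (Fin d)) (3 / 2) →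
      u x = ∫ y, u y • (𝓕⁻ Kh (-(x - y))).re := by
  have ha : 0 ≤ (d : ℝ) + 2 * s := by positivity
  have hk := hK.clm_comp Complex.reCLM
  simp only [Complex.reCLM_apply] at hk
  have hk' := hk.comp_neg
  set k : EuclideanSpace ℝ (Fin d) → ℝ := fun x => (𝓕⁻ Kh x).re with hkdef
  have hv := hk'.contDiff_integral ha hum hu
  have hul := locallyIntegrable_of_integrable_weight hum hu
  set v : EuclideanSpace ℝ (Fin d) → ℝ := fun x => ∫ y, u y • k (-(x - y)) with hvdef
  have hae := Metric.isOpen_ball.ae_eq_zero_of_integral_contDiff_smul_eq_zero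
    (U := Metric.ball (0 : EuclideanSpace ℝ (Fin d)) (3 / 2)) (f := fun x => u x - v x)
    (μ := volume)
    ((hul.sub hv.1.continuous.locallyIntegrable).locallyIntegrableOn _) (by
      intro ψ hψ hψc hψU
      have hψi : Integrable ψ := hψ.continuous.integrable_of_hasCompactSupport hψc
      have hψ0 : ∀ x, 3 / 2 < ‖x‖ → ψ x = 0 := fun x hx =>
        image_eq_zero_of_notMem_tsupport fun hx' => by
          have := hψU hx'
          rw [mem_ball_zero_iff] at this
          linarith
      have hφ0 : ∀ x, 7 / 4 < ‖x‖ → ∫ z, E z * ψ (x - z) = 0 := by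
        intro x hx
        refine integral_eq_zero_of_ae (Filter.Eventually.of_forall fun z => ?_)
        rcases le_or_gt ‖z‖ (1 / 4) with hz | hz
        · have := norm_sub_norm_le x z
          simp [hψ0 (x - z) (by linarith)]
        · simp [hE0 z hz]
      -- The test function `E ⋆ ψ` is admissible since `3/2 + 1/4 < 2`.
      let φ : 𝓓(openBall d 2, ℝ) :=
        { toFun := fun x => ∫ z, E z * ψ (x - z)
          contDiff' := hψc.contDiff_convolution_right (ContinuousLinearMap.lsmul ℝ ℝ)
            hE.locallyIntegrable hψ
          hasCompactSupport' := hasCompactSupport_of_norm hφ0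
          tsupport_subset' := by
            have h1 : tsupport (fun x => ∫ z, E z * ψ (x - z)) ⊆ Metric.closedBall 0 (7 / 4) := by
              refine closure_minimal (fun x hx => ?_) Metric.isClosed_closedBall
              by_contra hne
              exact hx (hφ0 x (by simpa using hne))
            exact h1.trans (Metric.closedBall_subset_ball (by norm_num)) }
      have hzero : ∫ y, (u y : ℂ) * (ψ y - ∫ x, 𝓕⁻ Kh (y - x) * ψ x) = 0 := by
        rw [← hharm φ]
        congr 1
        ext y
        rw [← fracLaplacian_convolution hE hKh hEK hψ hψc]
        rfl
      obtain ⟨C, hC0, hC⟩ := hK.norm_le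
      have hi1 : Integrable (fun y => ψ y * u y) := by
        have := hul.integrable_smul_left_of_hasCompactSupport hψ.continuous hψc
        simpa using this
      have hi2 : Integrable (fun z : EuclideanSpace ℝ (Fin d) × EuclideanSpace ℝ (Fin d) =>
          (u z.1 : ℂ) * (𝓕⁻ Kh (z.1 - z.2) * ψ z.2)) (volume.prod volume) := by
        have hψw : Integrable (fun x => |ψ x| * (1 + ‖x‖) ^ ((d : ℝ) + 2 * s)) := by
          refine Continuous.integrable_of_hasCompactSupport ?_ (hψc.norm.mul_right)
          refine hψ.continuous.abs.mul (Continuous.rpow_const (by fun_prop) fun x => ?_)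
          exact Or.inl (by positivity)
        refine ((hu.mul_prod hψw).const_mul C).mono' ?_ (Filter.Eventually.of_forall fun z => ?_)
        · refine (Complex.continuous_ofReal.comp_aestronglyMeasurable hum.comp_fst).mul
            (Continuous.aestronglyMeasurable ?_)
          have := hK.1.continuous
          have := hψ.continuous
          fun_prop
        · rw [norm_mul, norm_mul, Complex.norm_real, Complex.norm_real, Real.norm_eq_abs,
            Real.norm_eq_abs]
          have h1 := one_add_norm_rpow_neg_le ha z.2 z.1
          rw [norm_sub_rev] at h1
          calc |u z.1| * (‖𝓕⁻ Kh (z.1 - z.2)‖ * |ψ z.2|)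
              ≤ |u z.1| * ((C * ((1 + ‖z.2‖) ^ ((d : ℝ) + 2 * s) *
                (1 + ‖z.1‖) ^ (-((d : ℝ) + 2 * s)))) * |ψ z.2|) := by
                gcongr
                exact (hC _).trans (by gcongr)
            _ = _ := by ring
      have hi3 : Integrable (fun y => (u y : ℂ) * ∫ x, 𝓕⁻ Kh (y - x) * ψ x) := by
        have := hi2.integral_prod_left
        simpa only [integral_const_mul] using this
      have hsplit : ((∫ y, ψ y * u y : ℝ) : ℂ) = ∫ y, (u y : ℂ) * ∫ x, 𝓕⁻ Kh (y - x) * ψ x := by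
        have hi1' : Integrable (fun y => ((ψ y * u y : ℝ) : ℂ)) := hi1.ofReal
        rw [← sub_eq_zero, ← hzero, ← integral_complex_ofReal, ← integral_sub hi1' hi3]
        congr 1
        ext y
        push_cast
        ring
      have hswap : ∫ y, (u y : ℂ) * ∫ x, 𝓕⁻ Kh (y - x) * ψ x =
          ∫ x, ∫ y, (u y : ℂ) * (𝓕⁻ Kh (y - x) * ψ x) := by
        rw [← integral_integral_swap hi2]
        simp only [integral_const_mul]
      have hre : ∫ y, ψ y * u y = ∫ x, ψ x * v x := by
        have h1 := congrArg Complex.re (hsplit.trans hswap)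
        rw [Complex.ofReal_re] at h1
        rw [h1, ← RCLike.re_eq_complex_re, ← integral_re hi2.integral_prod_right]
        congr 1
        ext x
        have h2 : ∀ y, (u y : ℂ) * (𝓕⁻ Kh (y - x) * ψ x) =
          (ψ x : ℂ) * (u y * 𝓕⁻ Kh (y - x)) := fun y => by ring
        simp_rw [h2]
        rw [integral_const_mul, RCLike.re_eq_complex_re, Complex.re_ofReal_mul, hvdef]
        congr 1
        have h3 : Integrable (fun y => (u y : ℂ) * 𝓕⁻ Kh (y - x)) := by
          have := hK.comp_neg.integrable_smul_sub ha hum hu x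
          simpa [Complex.real_smul] using this
        rw [← RCLike.re_eq_complex_re, ← integral_re h3]
        congr 1
        ext y
        simp [hkdef]
      have hi4 : Integrable (fun x => ψ x * v x) :=
        Continuous.integrable_of_hasCompactSupport (hψ.continuous.mul hv.1.continuous)
          hψc.mul_right
      simp only [smul_eq_mul, mul_sub]
      rw [integral_sub hi1 hi4, hre, sub_self])
  filter_upwards [hae] with x hx hxU
  exact sub_eq_zero.1 (hx hxU)

end

/-! ### Scaling and bounds for partial derivatives -/

section
variable {d : ℕ} {s : ℝ}

theorem fracLaplacian_comp_inv_smul (φ : EuclideanSpace ℝ (Fin d) → ℝ) {R : ℝ} (hR : 0 < R)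
    (x : EuclideanSpace ℝ (Fin d)) :
    fracLaplacian s (fun x => φ (R⁻¹ • x)) x =
      ((R ^ (-(2 * s)) : ℝ) : ℂ) * fracLaplacian s φ (R⁻¹ • x) := by
  have hF : ∀ ξ, 𝓕 (fun x => (φ (R⁻¹ • x) : ℂ)) ξ =
      ((R ^ d : ℝ) : ℂ) * 𝓕 (fun x => (φ x : ℂ)) (R • ξ) := by
    intro ξ
    rw [← fourier_dilate φ hR, Real.fourier_eq, Real.fourier_eq, ← integral_const_mul]
    congr 1
    ext x
    have hRd : ((R : ℂ) ^ d) ≠ 0 := pow_ne_zero _ (Complex.ofReal_ne_zero.2 hR.ne')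
    simp only [Circle.smul_def, smul_eq_mul]
    push_cast
    field_simp
  unfold fracLaplacian
  rw [Real.fourierInv_eq, Real.fourierInv_eq, ← integral_const_mul]
  conv_rhs => rw [← integral_dilate _ (inv_pos.2 hR)]
  congr 1
  ext ξ
  rw [hF, inv_inv, inv_pow, inv_inv, norm_smul, Real.norm_of_nonneg hR.le, real_inner_smul_left,
    real_inner_smul_right, mul_inv_cancel_left₀ hR.ne',
    show 2 * Real.pi * (R * ‖ξ‖) = R * (2 * Real.pi * ‖ξ‖) by ring,
    Real.mul_rpow hR.le (by positivity), Real.rpow_neg hR.le]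
  have hRs : ((R ^ (2 * s) : ℝ) : ℂ) ≠ 0 :=
    Complex.ofReal_ne_zero.2 (Real.rpow_pos_of_pos hR _).ne'
  simp only [Circle.smul_def, smul_eq_mul, Complex.real_smul]
  push_cast
  field_simp

theorem IsDistribHarmonic.comp_smul {u : EuclideanSpace ℝ (Fin d) → ℝ} {r R : ℝ} (hR : 0 < R)
    (hu : IsDistribHarmonic s (openBall d (r * R)) u) :
    IsDistribHarmonic s (openBall d r) (fun x => u (R • x)) := by
  intro φ
  have hsub : tsupport (fun x => φ (R⁻¹ • x)) ⊆ Metric.ball 0 (r * R) := by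
    intro x hx
    have h1 : R⁻¹ • x ∈ tsupport φ :=
      tsupport_comp_subset_preimage φ (continuous_const_smul R⁻¹) hx
    have h2 : R⁻¹ • x ∈ Metric.ball (0 : EuclideanSpace ℝ (Fin d)) r := φ.tsupport_subset h1
    rw [mem_ball_zero_iff, norm_smul, norm_inv, Real.norm_of_nonneg hR.le, inv_mul_lt_iff₀ hR] at h2
    rw [mem_ball_zero_iff]
    linarith
  let φR : 𝓓(openBall d (r * R), ℝ) :=
    { toFun := fun x => φ (R⁻¹ • x)
      contDiff' := φ.contDiff.comp (contDiff_const_smul R⁻¹)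
      hasCompactSupport' := φ.hasCompactSupport.comp_smul (inv_ne_zero hR.ne')
      tsupport_subset' := hsub }
  have h1 := hu φR
  have h2 : ∀ x, (u x : ℂ) * fracLaplacian s φR x = ((R ^ (-(2 * s)) : ℝ) : ℂ) *
      ((u (R • (R⁻¹ • x)) : ℂ) * fracLaplacian s φ (R⁻¹ • x)) := by
    intro x
    have h3 := fracLaplacian_comp_inv_smul (s := s) φ hR x
    have h4 : fracLaplacian s φR x = fracLaplacian s (fun x => φ (R⁻¹ • x)) x := rfl
    rw [h4, h3, smul_inv_smul₀ hR.ne']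
    ring
  simp_rw [h2] at h1
  rw [integral_const_mul, mul_eq_zero, Measure.integral_comp_inv_smul_of_nonneg volume
    (fun x => (u (R • x) : ℂ) * fracLaplacian s φ x) hR.le, smul_eq_zero] at h1
  rcases h1 with h1 | h1 | h1
  · exact absurd h1 (Complex.ofReal_ne_zero.2 (Real.rpow_pos_of_pos hR _).ne')
  · exact absurd h1 (pow_ne_zero _ hR.ne')
  · exact h1

theorem norm_iteratedFDeriv_partialDeriv_le (i : Fin d) {f : EuclideanSpace ℝ (Fin d) → ℝ}
    (hf : ContDiff ℝ ∞ f) (k : ℕ) (x : EuclideanSpace ℝ (Fin d)) :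
    ‖iteratedFDeriv ℝ k (partialDeriv i f) x‖ ≤ ‖iteratedFDeriv ℝ (k + 1) f x‖ := by
  let L : (EuclideanSpace ℝ (Fin d) →L[ℝ] ℝ) →L[ℝ] ℝ :=
    ContinuousLinearMap.apply ℝ ℝ (EuclideanSpace.single i 1)
  have hL : ‖L‖ ≤ 1 := by
    refine ContinuousLinearMap.opNorm_le_bound _ zero_le_one fun A => ?_
    have := A.le_opNorm (EuclideanSpace.single i 1)
    simpa [L] using this
  have hf' : ContDiff ℝ ∞ (fderiv ℝ f) := hf.fderiv_right (by norm_cast)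
  have h1 := L.norm_iteratedFDeriv_comp_left (hf'.contDiffAt (x := x)) (n := k)
    (by exact_mod_cast le_top)
  rw [norm_iteratedFDeriv_fderiv] at h1
  exact h1.trans (mul_le_of_le_one_left (norm_nonneg _) hL)

theorem iterate_partialDeriv_bound (i : Fin d) (m : ℕ) {f : EuclideanSpace ℝ (Fin d) → ℝ}
    (hf : ContDiff ℝ ∞ f) : ContDiff ℝ ∞ ((partialDeriv i)^[m] f) ∧ ∀ k x,
      ‖iteratedFDeriv ℝ k ((partialDeriv i)^[m] f) x‖ ≤ ‖iteratedFDeriv ℝ (k + m) f x‖ := by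
  induction m with
  | zero => exact ⟨hf, fun k x => le_rfl⟩
  | succ m ih =>
    rw [Function.iterate_succ_apply']
    refine ⟨contDiff_partialDeriv i ih.1, fun k x => ?_⟩
    refine (norm_iteratedFDeriv_partialDeriv_le i ih.1 k x).trans ((ih.2 (k + 1) x).trans ?_)
    rw [add_right_comm, add_assoc]

theorem abs_multiDeriv_le (n : Fin d → ℕ) {f : EuclideanSpace ℝ (Fin d) → ℝ}
    (hf : ContDiff ℝ ∞ f) (x : EuclideanSpace ℝ (Fin d)) :
    |multiDeriv n f x| ≤ ‖iteratedFDeriv ℝ (∑ i, n i) f x‖ := by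
  have key : ∀ l : List (Fin d),
      ContDiff ℝ ∞ (l.foldr (fun i g => (partialDeriv i)^[n i] g) f) ∧ ∀ k x,
      ‖iteratedFDeriv ℝ k (l.foldr (fun i g => (partialDeriv i)^[n i] g) f) x‖ ≤
        ‖iteratedFDeriv ℝ (k + (l.map n).sum) f x‖ := by
    intro l
    induction l with
    | nil => exact ⟨hf, fun k x => le_rfl⟩
    | cons i l ih =>
      obtain ⟨h1, h2⟩ := iterate_partialDeriv_bound i (n i) ih.1
      refine ⟨h1, fun k x => (h2 k x).trans ((ih.2 _ x).trans ?_)⟩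
      rw [List.map_cons, List.sum_cons, add_assoc]
  have := (key (List.finRange d)).2 0 x
  rw [norm_iteratedFDeriv_zero, zero_add, ← Fin.sum_univ_def] at this
  exact this

variable {a : ℝ} {u : EuclideanSpace ℝ (Fin d) → ℝ}

theorem integrable_weight_comp_smul (ha : 0 ≤ a) (hum : AEStronglyMeasurable u)
    (hu : Integrable (fun y => |u y| * (1 + ‖y‖) ^ (-a))) {R : ℝ} (hR : 0 < R) :
    AEStronglyMeasurable (fun x => u (R • x)) ∧
      Integrable (fun y => |u (R • y)| * (1 + ‖y‖) ^ (-a)) := by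
  have hc : Continuous fun y : EuclideanSpace ℝ (Fin d) => (1 + R⁻¹ * ‖y‖) ^ (-a) :=
    Continuous.rpow_const (by fun_prop) fun y => Or.inl (by positivity)
  constructor
  · exact hum.comp_quasiMeasurePreserving (Measure.quasiMeasurePreserving_smul volume hR.ne')
  · have h1 : Integrable (fun y => |u y| * (1 + R⁻¹ * ‖y‖) ^ (-a)) := by
      refine (hu.const_mul ((min 1 R⁻¹) ^ (-a))).mono' (hum.norm.mul hc.aestronglyMeasurable)
        (Filter.Eventually.of_forall fun y => ?_)
      rw [Real.norm_of_nonneg (by positivity), mul_left_comm]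
      have hm : 0 < min 1 R⁻¹ := lt_min one_pos (inv_pos.2 hR)
      gcongr
      rw [← Real.mul_rpow hm.le (by positivity)]
      refine Real.rpow_le_rpow_of_nonpos (by positivity) ?_ (by linarith)
      have h2 : min 1 R⁻¹ ≤ 1 := min_le_left _ _
      have h3 : min 1 R⁻¹ * ‖y‖ ≤ R⁻¹ * ‖y‖ := by gcongr; exact min_le_right _ _
      linarith
    refine (h1.comp_smul hR.ne').congr (Filter.Eventually.of_forall fun y => ?_)
    simp only [norm_smul, Real.norm_of_nonneg hR.le, inv_mul_cancel_left₀ hR.ne']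

theorem integral_one_add_norm_weight_le (ha : 0 ≤ a) (hum : AEStronglyMeasurable u)
    (hu : Integrable (fun y => |u y| * (1 + ‖y‖) ^ (-a))) :
    ∫ y, |u y| * (1 + ‖y‖) ^ (-a) ≤ 2 * ∫ y, |u y| / (1 + ‖y‖ ^ a) := by
  have hc : Continuous fun y : EuclideanSpace ℝ (Fin d) => ‖y‖ ^ a :=
    continuous_norm.rpow_const fun y => Or.inr ha
  have hlow : ∀ y : EuclideanSpace ℝ (Fin d), 1 + ‖y‖ ^ a ≤ 2 * (1 + ‖y‖) ^ a := by
    intro y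
    have h1 : 1 ≤ (1 + ‖y‖) ^ a := Real.one_le_rpow (by linarith [norm_nonneg y]) ha
    have h2 : ‖y‖ ^ a ≤ (1 + ‖y‖) ^ a := by gcongr; linarith
    linarith
  have hup : ∀ y : EuclideanSpace ℝ (Fin d), (1 + ‖y‖) ^ a ≤ 2 ^ a * (1 + ‖y‖ ^ a) := by
    intro y
    have h0 : 0 ≤ ‖y‖ ^ a := by positivity
    rcases le_total ‖y‖ 1 with h | h
    · calc (1 + ‖y‖) ^ a ≤ 2 ^ a := by gcongr; linarith
        _ ≤ _ := le_mul_of_one_le_right (by positivity) (by linarith)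
    · calc (1 + ‖y‖) ^ a ≤ (2 * ‖y‖) ^ a := by gcongr; linarith
        _ = 2 ^ a * ‖y‖ ^ a := Real.mul_rpow (by norm_num) (norm_nonneg _)
        _ ≤ _ := by gcongr; linarith
  have hi : Integrable (fun y => |u y| / (1 + ‖y‖ ^ a)) := by
    refine (hu.const_mul (2 ^ a)).mono' (hum.norm.div₀ ?_)
      (Filter.Eventually.of_forall fun y => ?_)
    · exact (continuous_const.add hc).aestronglyMeasurable
    · rw [Real.norm_of_nonneg (by positivity), mul_left_comm, div_eq_mul_inv]
      gcongr
      rw [Real.rpow_neg (by positivity), ← div_eq_mul_inv, le_div_iff₀ (by positivity),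
        inv_mul_le_iff₀ (by positivity), mul_comm]
      exact hup y
  rw [← integral_const_mul]
  refine integral_mono hu (hi.const_mul 2) fun y => ?_
  simp only
  rw [div_eq_mul_inv, mul_left_comm]
  gcongr
  rw [Real.rpow_neg (by positivity), ← div_eq_mul_inv, le_div_iff₀ (by positivity),
    inv_mul_le_iff₀ (by positivity), mul_comm]
  exact hlow y

theorem integral_weight_comp_smul (u : EuclideanSpace ℝ (Fin d) → ℝ) (b : ℝ) {R : ℝ}
    (hR : 0 < R) :
    ∫ y, |u (R • y)| / (1 + ‖y‖ ^ ((d : ℝ) + b)) =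
      R ^ b * ∫ y, |u y| / (R ^ ((d : ℝ) + b) + ‖y‖ ^ ((d : ℝ) + b)) := by
  have h1 := Measure.integral_comp_smul_of_nonneg (volume : Measure (EuclideanSpace ℝ (Fin d)))
    (fun y => R ^ ((d : ℝ) + b) * (|u y| / (R ^ ((d : ℝ) + b) + ‖y‖ ^ ((d : ℝ) + b)))) R
    (hR := hR.le)
  have h2 : ∀ y : EuclideanSpace ℝ (Fin d), |u (R • y)| / (1 + ‖y‖ ^ ((d : ℝ) + b)) =
      R ^ ((d : ℝ) + b) * (|u (R • y)| / (R ^ ((d : ℝ) + b) + ‖R • y‖ ^ ((d : ℝ) + b))) := by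
    intro y
    have h3 : 0 < R ^ ((d : ℝ) + b) := by positivity
    rw [norm_smul, Real.norm_of_nonneg hR.le, Real.mul_rpow hR.le (norm_nonneg _)]
    have h4 : R ^ ((d : ℝ) + b) + R ^ ((d : ℝ) + b) * ‖y‖ ^ ((d : ℝ) + b) =
      R ^ ((d : ℝ) + b) * (1 + ‖y‖ ^ ((d : ℝ) + b)) := by ring
    rw [h4, ← mul_div_assoc, mul_div_mul_left _ _ h3.ne']
  simp_rw [h2]
  rw [h1, integral_const_mul, finrank_euclideanSpace_fin, smul_eq_mul, ← mul_assoc,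
    Real.rpow_add hR, Real.rpow_natCast, inv_mul_cancel_left₀ (by positivity)]

end

end FractionalLaplacian

theorem lemma3p1 (d : ℕ) (hd : 2 ≤ d) (s : ℝ) (hs : 0 < s) (hsd : s < (d : ℝ) / 2) :
    ∃ C : (Fin d → ℕ) → ℝ, (∀ n, 0 < C n) ∧
      ∀ R : ℝ, 0 < R → ∀ u : EuclideanSpace ℝ (Fin d) → ℝ,
        FractionalLaplacian.MemWeightedL1 s u →
        FractionalLaplacian.IsDistribHarmonic s (FractionalLaplacian.openBall d (2 * R)) u →
        ∃ v : EuclideanSpace ℝ (Fin d) → ℝ,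
          ContDiff ℝ ∞ v ∧
          (∀ᵐ x ∂volume, x ∈ Metric.closedBall 0 R → u x = v x) ∧
          ∀ n : Fin d → ℕ, ∀ x ∈ Metric.closedBall (0 : EuclideanSpace ℝ (Fin d)) R,
            |FractionalLaplacian.multiDeriv n v x| ≤
              C n * R ^ (2 * s - ∑ i, (n i : ℝ)) *
                ∫ y, |u y| / (R ^ ((d : ℝ) + 2 * s) + ‖y‖ ^ ((d : ℝ) + 2 * s)) := by
  obtain ⟨E, Kh, hE, hE0, hKh, hK, hEK⟩ :=
    FractionalLaplacian.exists_parametrix (by omega : 0 < d) hs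
  have ha : 0 ≤ (d : ℝ) + 2 * s := by positivity
  have hk := (hK.clm_comp Complex.reCLM).comp_neg
  simp only [Complex.reCLM_apply] at hk
  choose M hM0 hM using hk.bound
  refine ⟨fun n => M (∑ i, n i) * (2 ^ ((d : ℝ) + 2 * s) * 2), fun n => ?_, ?_⟩
  · have := hM0 (∑ i, n i)
    positivity
  intro R hR u ⟨hul, huw⟩ hharm
  have hu : Integrable (fun y => |u y| * (1 + ‖y‖) ^ (-((d : ℝ) + 2 * s))) := by
    refine huw.congr (Filter.Eventually.of_forall fun y => ?_)
    simp only
    rw [Real.rpow_neg (by positivity), div_eq_mul_inv]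
  obtain ⟨hwm, hwi⟩ :=
    FractionalLaplacian.integrable_weight_comp_smul ha hul.aestronglyMeasurable hu hR
  have hae := FractionalLaplacian.ae_eq_convolution_of_isDistribHarmonic hs hE hE0 hKh hK hEK
    hwm hwi (hharm.comp_smul hR)
  obtain ⟨hvs, hvb⟩ := hk.contDiff_integral ha hwm hwi
  set v : EuclideanSpace ℝ (Fin d) → ℝ :=
    fun x => ∫ y, u (R • y) • (𝓕⁻ Kh (-(x - y))).re with hv
  have hvR : ContDiff ℝ ∞ (fun x => v (R⁻¹ • x)) := hvs.comp (contDiff_const_smul R⁻¹)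
  refine ⟨fun x => v (R⁻¹ • x), hvR, ?_, ?_⟩
  · have h1 := (Measure.quasiMeasurePreserving_smul
      (volume : Measure (EuclideanSpace ℝ (Fin d))) (inv_ne_zero hR.ne')).ae hae
    filter_upwards [h1] with x hx hxR
    rw [mem_closedBall_zero_iff] at hxR
    rw [smul_inv_smul₀ hR.ne'] at hx
    refine hx ?_
    rw [mem_ball_zero_iff, norm_smul, norm_inv, Real.norm_of_nonneg hR.le, inv_mul_lt_iff₀ hR]
    linarith
  · intro n x hx
    rw [mem_closedBall_zero_iff] at hx
    have hx1 : ‖R⁻¹ • x‖ ≤ 1 := by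
      rw [norm_smul, norm_inv, Real.norm_of_nonneg hR.le, inv_mul_le_iff₀ hR]
      linarith
    set m := ∑ i, n i with hm
    have hmR : ∑ i, (n i : ℝ) = (m : ℝ) := by rw [hm]; push_cast; rfl
    have hw0 : 0 ≤ ∫ y, |u (R • y)| * (1 + ‖y‖) ^ (-((d : ℝ) + 2 * s)) :=
      integral_nonneg fun y => by positivity
    have h1 : ∫ y, |u (R • y)| * (1 + ‖R⁻¹ • x - y‖) ^ (-((d : ℝ) + 2 * s)) ≤
        2 ^ ((d : ℝ) + 2 * s) * ∫ y, |u (R • y)| * (1 + ‖y‖) ^ (-((d : ℝ) + 2 * s)) := by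
      rw [← integral_const_mul]
      refine integral_mono
        (FractionalLaplacian.integrable_mul_one_add_norm_sub ha hwm hwi _) (hwi.const_mul _)
        fun y => ?_
      simp only
      rw [mul_left_comm]
      gcongr
      refine (FractionalLaplacian.one_add_norm_rpow_neg_le ha _ y).trans ?_
      gcongr
      linarith
    have hM0' := hM0 m
    calc |FractionalLaplacian.multiDeriv n (fun x => v (R⁻¹ • x)) x|
        ≤ ‖iteratedFDeriv ℝ m (fun x => v (R⁻¹ • x)) x‖ :=
          FractionalLaplacian.abs_multiDeriv_le n hvR x
      _ = (R⁻¹) ^ m * ‖iteratedFDeriv ℝ m v (R⁻¹ • x)‖ := by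
          rw [iteratedFDeriv_comp_const_smul _ (hvs.of_le (by exact_mod_cast le_top)), norm_smul,
            Real.norm_of_nonneg (by positivity)]
      _ ≤ (R⁻¹) ^ m * (M m * ∫ y, |u (R • y)| *
            (1 + ‖R⁻¹ • x - y‖) ^ (-((d : ℝ) + 2 * s))) := by
          gcongr
          exact hvb m (M m) (hM m) _
      _ ≤ (R⁻¹) ^ m * (M m * (2 ^ ((d : ℝ) + 2 * s) *
            (2 * ∫ y, |u (R • y)| / (1 + ‖y‖ ^ ((d : ℝ) + 2 * s))))) := by
          gcongr
          refine h1.trans ?_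
          gcongr
          exact FractionalLaplacian.integral_one_add_norm_weight_le ha hwm hwi
      _ = _ := by
          rw [FractionalLaplacian.integral_weight_comp_smul u (2 * s) hR, hmR, Real.rpow_sub hR,
            Real.rpow_natCast, inv_pow]
          ring
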